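/- Let $0<r<1$, $\alpha\ge 1/2$, and let $\Omega=\{z\in\mathbb C:\ r<|z|<1,\ 0<\arg z<\pi/\alpha\}$ (with $\arg z\in[0,2\pi)$). Its boundary, oriented counter-clockwise, consists of the segment $[r,1]$, the arc $\Gamma_1:\ t\mapsto e^{it}$ ($t$ from $0$ to $\pi/\alpha$), the segment $[\varpi,\omega]$ from $\varpi=e^{i\pi/\alpha}$ to $\omega=re^{i\pi/\alpha}$, and the arc $\Gamma_2:\ t\mapsto re^{it}$ ($t$ from $\pi/\alpha$ to $0$). For $\tau=\rho e^{it}$ with $r\le\rho\le1$, $0\le t\le\pi/\alpha$ and real $a$, put $\tau^{a}=\rho^{a}e^{iat}$, where $t=0$ on $[r,1]$ and $t=\pi/\alpha$ on $[\varpi,\omega]$ (this matters only for $\alpha=1/2$, where these segments are the two sides of the slit). Define $$H_1(z,\zeta)=\frac{\zeta+z}{\zeta-z}-\frac{\overline\zeta+z}{\overline\zeta-z}+2\sum_{n=1}^\infty r^{2\alpha n}\left[\frac{\zeta}{r^{2\alpha n}\zeta-z}-\frac{z}{r^{2\alpha n}z-\zeta}-\frac{\overline\zeta}{r^{2\alpha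 n}\overline\zeta-z}+\frac{z}{r^{2\alpha n}z-\overline\zeta}\right],$$ $$H_2(z,\zeta)=\frac1{\zeta-z}-\frac{z}{1-z\zeta}+\sum_{n=1}^\infty r^{2\alpha n}\left[\frac1{r^{2\alpha n}\zeta-z}-\frac{z}{\zeta(r^{2\alpha n}z-\zeta)}-\frac1{\zeta(r^{2\alpha n}-z\zeta)}+\frac{z}{r^{2\alpha n}z\zeta-1}\right].$$ **Theorem 2.1.** Let $w\in C^1(\Omega;\mathbb C)\cap C(\overline\Omega;\mathbb C)$ (with $C^1$ in the real sense) and let $w_{\bar\tau}=\tfrac12(\partial_{\tau_1}w+i\,\partial_{\tau_2}w)$, $\tau=\tau_1+i\tau_2$. Then for every $z\in\Omega$ $$\begin{aligned}w(z)={}&\frac{\alpha}{2\pi i}\int_{\Gamma_1\cup\Gamma_2}\operatorname{Re}w(\tau)\,H_1(z^\alpha,\tau^\alpha)\frac{d\tau}{\tau}+\frac{\alpha}{\pi i}\int_{[\varpi,\omega]\cup[r,1]}\operatorname{Re}w(\tau)\,H_2(z^\alpha,\tau^\alpha)\,\tau^{\alpha-1}\,d\tau+\frac{\alpha}{\pi}\int_{\Gamma_1}\frac{\operatorname{Im}w(\tau)}{\tau}\,d\tau\\&-\frac{\alpha}{\pi}\iint_{\Omega}\Big[\tau^{\alpha-1}H_2(z^\alpha,\tau^\alpha)\,w_{\bar\tau}(\tau)-\overline{\tau^{\alpha-1}}\,H_2(z^\alpha,\overline{\tau^\alpha})\,\overline{w_{\bar\tau}(\tau)}\Big]d\tau_1\,d\tau_2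 .\end{aligned}$$ Here the area integral exists as the limit, as $r_1\downarrow r$, $r_2\uparrow1$, $a\downarrow0$, $b\uparrow\pi/\alpha$ independently, of the Lebesgue integrals, which exist, over the smaller sector rings $\{r_1<|\tau|<r_2,\ a<\arg\tau<b\}$. If $w_{\bar\tau}$ is Lebesgue integrable on $\Omega$, then the integrand is Lebesgue integrable on $\Omega$ and the area integral is its Lebesgue integral. -/

import Mathlib

open MeasureTheory Filter Topology
open scoped ComplexConjugate

namespace SectorRing

noncomputable section

/-- The argument of a complex number, normalised to lie in `[0, 2π)`. -/
def argPos (z : ℂ) : ℝ := toIcoMod Real.two_pi_pos 0 z.arg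

/-- The open sector ring `{r₁ < |z| < r₂, a < arg z < b}`, with `arg z ∈ [0, 2π)`. -/
def region (r₁ r₂ a b : ℝ) : Set ℂ :=
  {z | r₁ < ‖z‖ ∧ ‖z‖ < r₂ ∧ a < argPos z ∧ argPos z < b}

/-- The sector ring `Ω = {r < |z| < 1, 0 < arg z < π / α}`. -/
def Omega (r α : ℝ) : Set ℂ := region r 1 0 (Real.pi / α)

/-- The point `ρ e^{it}`. -/
def polar (ρ t : ℝ) : ℂ := (ρ : ℂ) * Complex.exp ((t : ℂ) * Complex.I)

/-- The value `ρ^a e^{iat}` of the power `τ^a` at the point `τ = ρ e^{it}`, when `t` is the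
value of its argument. With `0 ≤ t ≤ π / α` this is the branch used on the closed sector ring;
the explicit `t` matters only for `α = 1/2`, where the edges `t = 0` and `t = 2π` are the two
sides of the slit. -/
def polarPow (a ρ t : ℝ) : ℂ :=
  ((ρ ^ a : ℝ) : ℂ) * Complex.exp (((a * t : ℝ) : ℂ) * Complex.I)

/-- The branch of `z ↦ z^a` on the plane cut along the positive real axis. -/
def branchPow (a : ℝ) (z : ℂ) : ℂ := polarPow a ‖z‖ (argPos z)

/-- The kernel `H₁`; the summation index is `n + 1`, `n = 0, 1, 2, …`. -/
def H₁ (r α : ℝ) (z ζ : ℂ) : ℂ :=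
  (ζ + z) / (ζ - z) - (conj ζ + z) / (conj ζ - z)
    + 2 * ∑' n : ℕ, ((r ^ (2 * α * (n + 1)) : ℝ) : ℂ) *
        (ζ / (((r ^ (2 * α * (n + 1)) : ℝ) : ℂ) * ζ - z)
          - z / (((r ^ (2 * α * (n + 1)) : ℝ) : ℂ) * z - ζ)
          - conj ζ / (((r ^ (2 * α * (n + 1)) : ℝ) : ℂ) * conj ζ - z)
          + z / (((r ^ (2 * α * (n + 1)) : ℝ) : ℂ) * z - conj ζ))

/-- The kernel `H₂`; the summation index is `n + 1`, `n = 0, 1, 2, …`. -/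
def H₂ (r α : ℝ) (z ζ : ℂ) : ℂ :=
  1 / (ζ - z) - z / (1 - z * ζ)
    + ∑' n : ℕ, ((r ^ (2 * α * (n + 1)) : ℝ) : ℂ) *
        (1 / (((r ^ (2 * α * (n + 1)) : ℝ) : ℂ) * ζ - z)
          - z / (ζ * (((r ^ (2 * α * (n + 1)) : ℝ) : ℂ) * z - ζ))
          - 1 / (ζ * (((r ^ (2 * α * (n + 1)) : ℝ) : ℂ) - z * ζ))
          + z / (((r ^ (2 * α * (n + 1)) : ℝ) : ℂ) * z * ζ - 1))

/-- The Cauchy–Riemann (Wirtinger) derivative `w_z̄ = (w_x + i w_y) / 2`. -/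
def dbar (w : ℂ → ℂ) (z : ℂ) : ℂ :=
  (1 / 2) * (fderiv ℝ w z 1 + Complex.I * fderiv ℝ w z Complex.I)

/-- The line integral `∫ F dτ` along the arc `τ = ρ e^{it}`, `t` running from `a` to `b`;
the integrand `F` is given in polar coordinates, and `dτ = i ρ e^{it} dt`. -/
def arcIntegral (ρ a b : ℝ) (F : ℝ → ℝ → ℂ) : ℂ :=
  ∫ t in a..b, F ρ t * (Complex.I * polar ρ t)

/-- The line integral `∫ F dτ` along the radial segment `τ = ρ e^{it}`, `ρ` running from `p`
to `q`; the integrand `F` is given in polar coordinates, and `dτ = e^{it} dρ`. -/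
def rayIntegral (t p q : ℝ) (F : ℝ → ℝ → ℂ) : ℂ :=
  ∫ ρ in p..q, F ρ t * Complex.exp ((t : ℂ) * Complex.I)

/-- The integrand
`τ^{α-1} H₂(z^α, τ^α) w_τ̄(τ) - conj(τ^{α-1}) H₂(z^α, conj(τ^α)) conj(w_τ̄(τ))`
of the area integral. -/
def areaIntegrand (r α : ℝ) (w : ℂ → ℂ) (z τ : ℂ) : ℂ :=
  branchPow (α - 1) τ * H₂ r α (branchPow α z) (branchPow α τ) * dbar w τ
    - conj (branchPow (α - 1) τ) * H₂ r α (branchPow α z) (conj (branchPow α τ))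
        * conj (dbar w τ)

/-- `J` is the (possibly improper) area integral of `g` over `Ω`: `g` is Lebesgue integrable on
every smaller sector ring `{r₁ < |τ| < r₂, a < arg τ < b}` with `r < r₁`, `r₂ < 1`, `0 < a`,
`b < π / α`, and its integrals over these tend to `J` as `r₁ ↓ r`, `r₂ ↑ 1`, `a ↓ 0`,
`b ↑ π / α` (independently of each other). -/
def HasAreaIntegral (r α : ℝ) (g : ℂ → ℂ) (J : ℂ) : Prop :=
  (∀ r₁ r₂ a b : ℝ, r < r₁ → r₂ < 1 → 0 < a → b < Real.pi / α →
      IntegrableOn g (region r₁ r₂ a b) volume) ∧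
  Tendsto (fun p : (ℝ × ℝ) × (ℝ × ℝ) => ∫ τ in region p.1.1 p.1.2 p.2.1 p.2.2, g τ)
    ((𝓝[>] r ×ˢ 𝓝[<] (1 : ℝ)) ×ˢ (𝓝[>] (0 : ℝ) ×ˢ 𝓝[<] (Real.pi / α))) (𝓝 J)

end

end SectorRing

/-!
Everything is pulled back along `τ = exp s`, which maps the open rectangle `(log r, 0) × (0, π/α)`
onto the sector ring and makes every power of `τ` an exponential `exp (a * s)`; in particular the
choice of the branch disappears. Write `ζ = exp (α * s)`, `Z = exp (α * s₀)` for the images of `τ`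
and `z = exp s₀` in the half ring, and `K(s) = α * ζ * H₂(Z, ζ)` for the kernel `stripKernel`.

* `K` is holomorphic on the closed rectangle except for a simple pole of residue `1` at `s₀`
  (`stripKernel_eq`, `differentiableAt_stripReg`), and its reflection `conj (K (conj s))` has no
  pole there at all (`differentiableAt_conj_stripKernel`). Convergence and holomorphy come from
  writing `ζ * H₂` with four values of the Lambert series `∑ Qⁿ x / (1 - Qⁿ x)`, `Q = r^(2α)`
  (`mul_H₂_eq`).
* The Cauchy-Pompeiu formula on rectangles (`rectContour_div_sub`) for `w ∘ exp` and `K`, added to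
  the conjugate of Green's theorem for `w ∘ exp` and the reflected kernel, gives
  `2πi w(z) + 2i ∬ (∂̄w K(s) - conj (∂̄w) K(conj s)) = ∮ w K(s) ds + conj (∮ w conj (K (conj s)) ds)`
  on each closed rectangle in the open one (`KernelPair.contour_identity`), where `w` stands for
  `w ∘ exp` under the integral signs. Up to the Jacobian of the exponential and a factor
  `1 / α`, the area integrand is the one of the theorem (`norm_exp_sq_mul_areaIntegrand`).
* On the boundary the symmetries of the kernel do the rest (`boundary_eq`). On the two edges `ζ` is
  real, so that only `2 Re w` survives. On the arcs, inversion in the circle permutes the Lambert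
  series, up to one term: `ζ H₂(Z, ζ) - ζ̄ H₂(Z, ζ̄)` is `H₁` on both arcs, whereas the sum
  `ζ H₂(Z, ζ) + ζ̄ H₂(Z, ζ̄)` is `2` on the outer arc, which produces the integral of `Im w`, and
  `0` on the inner arc (`logKernel_of_norm_eq_one`, `logKernel_of_norm_sq_eq`).
* `w` is `C¹` only in the open sector ring. The boundary integrals over smaller rectangles converge
  by continuity of `w` up to the boundary (`tendsto_rectContour_rect`), hence so do the area
  integrals. If `∂̄w` is integrable, so is the area integrand, because the kernel is bounded away
  from its pole and `∂̄w` is bounded near it (`integrableOn_mul_inv_sub`).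
-/

namespace SectorRing

/-! ### Lambert series and the kernels `H₁`, `H₂` -/

/-- The Lambert-type series `∑_{n ≥ 1} Qⁿ x / (1 - Qⁿ x)`, holomorphic for `Q * ‖x‖ < 1`. -/
noncomputable def lambert (Q : ℝ) (x : ℂ) : ℂ :=
  ∑' n : ℕ, (Q : ℂ) ^ (n + 1) * x / (1 - (Q : ℂ) ^ (n + 1) * x)

section Lambert

variable {Q : ℝ}

lemma norm_pow_succ_mul_le (hQ0 : 0 < Q) (hQ1 : Q < 1) (x : ℂ) (n : ℕ) :
    ‖(Q : ℂ) ^ (n + 1) * x‖ ≤ Q * ‖x‖ := by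
  rw [norm_mul, norm_pow, Complex.norm_real, Real.norm_of_nonneg hQ0.le]
  gcongr
  exact pow_le_of_le_one hQ0.le hQ1.le (Nat.succ_ne_zero n)

lemma one_sub_pow_succ_mul_ne_zero (hQ0 : 0 < Q) (hQ1 : Q < 1) {x : ℂ} (hx : Q * ‖x‖ < 1)
    (n : ℕ) : 1 - (Q : ℂ) ^ (n + 1) * x ≠ 0 := by
  intro h
  have h1 := norm_pow_succ_mul_le hQ0 hQ1 x n
  rw [← sub_eq_zero.1 h, norm_one] at h1
  linarith

lemma norm_lambert_term_le (hQ0 : 0 < Q) (hQ1 : Q < 1) {x : ℂ} {ρ : ℝ} (hρ : Q * ρ < 1)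
    (hx : ‖x‖ ≤ ρ) (n : ℕ) :
    ‖(Q : ℂ) ^ (n + 1) * x / (1 - (Q : ℂ) ^ (n + 1) * x)‖ ≤
      Q ^ n * (Q * ρ / (1 - Q * ρ)) := by
  have hd : 1 - Q * ρ ≤ ‖1 - (Q : ℂ) ^ (n + 1) * x‖ := by
    have h1 := norm_sub_norm_le (1 : ℂ) ((Q : ℂ) ^ (n + 1) * x)
    have h2 := norm_pow_succ_mul_le hQ0 hQ1 x n
    have h3 : Q * ‖x‖ ≤ Q * ρ := by gcongr
    rw [norm_one] at h1
    linarith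
  have hn : ‖(Q : ℂ) ^ (n + 1) * x‖ ≤ Q ^ n * (Q * ρ) := by
    rw [norm_mul, norm_pow, Complex.norm_real, Real.norm_of_nonneg hQ0.le, pow_succ, mul_assoc]
    gcongr
  rw [norm_div, ← mul_div_assoc]
  have h0 : 0 ≤ Q ^ n * (Q * ρ) := (norm_nonneg _).trans hn
  exact div_le_div₀ h0 hn (by linarith) hd

lemma summable_lambert_bound (hQ0 : 0 < Q) (hQ1 : Q < 1) (c : ℝ) :
    Summable fun n : ℕ => Q ^ n * c :=
  (summable_geometric_of_lt_one hQ0.le hQ1).mul_right c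

lemma hasSum_lambert (hQ0 : 0 < Q) (hQ1 : Q < 1) {x : ℂ} (hx : Q * ‖x‖ < 1) :
    HasSum (fun n : ℕ => (Q : ℂ) ^ (n + 1) * x / (1 - (Q : ℂ) ^ (n + 1) * x)) (lambert Q x) :=
  (Summable.of_norm_bounded (summable_lambert_bound hQ0 hQ1 _)
    (norm_lambert_term_le hQ0 hQ1 hx le_rfl)).hasSum

lemma differentiableAt_lambert (hQ0 : 0 < Q) (hQ1 : Q < 1) {x : ℂ} (hx : Q * ‖x‖ < 1) :
    DifferentiableAt ℂ (lambert Q) x := by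
  obtain ⟨ρ, h1, h2⟩ := exists_between ((lt_div_iff₀' hQ0).2 hx)
  have h2' : Q * ρ < 1 := (lt_div_iff₀' hQ0).1 h2
  have hd := Complex.differentiableOn_tsum_of_summable_norm (U := Metric.ball 0 ρ)
    (F := fun (n : ℕ) (x : ℂ) => (Q : ℂ) ^ (n + 1) * x / (1 - (Q : ℂ) ^ (n + 1) * x))
    (summable_lambert_bound hQ0 hQ1 (Q * ρ / (1 - Q * ρ))) ?_ Metric.isOpen_ball ?_
  · exact hd.differentiableAt (Metric.isOpen_ball.mem_nhds (by simpa using h1))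
  · intro n y hy
    have hy' : ‖y‖ < ρ := by simpa using hy
    have hne := one_sub_pow_succ_mul_ne_zero hQ0 hQ1 (x := y)
      (lt_of_le_of_lt (by gcongr) h2') n
    exact (DifferentiableAt.div (c := fun y => (Q : ℂ) ^ (n + 1) * y)
      (d := fun y => 1 - (Q : ℂ) ^ (n + 1) * y) (by fun_prop)
      (by fun_prop) hne).differentiableWithinAt
  · intro n y hy
    exact norm_lambert_term_le hQ0 hQ1 h2' (le_of_lt (by simpa using hy)) n

lemma lambert_mul (hQ0 : 0 < Q) (hQ1 : Q < 1) {x : ℂ} (hx : Q * ‖x‖ < 1) :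
    lambert Q (Q * x) = lambert Q x - Q * x / (1 - Q * x) := by
  have h := (hasSum_lambert hQ0 hQ1 hx).summable.tsum_eq_zero_add
  have h' : lambert Q x = Q * x / (1 - Q * x) + lambert Q (Q * x) := by
    rw [lambert, h, lambert]
    congr 1
    · simp
    · refine tsum_congr fun n => ?_
      ring_nf
  rw [h']; ring

end Lambert

/-- The part of the kernel `ζ * H₂(Z, ζ)` that is regular at `ζ = Z`. -/
noncomputable def regKernel (Q : ℝ) (Z ζ : ℂ) : ℂ :=
  -(Z * ζ / (1 - Z * ζ)) - lambert Q (ζ / Z) + lambert Q (Z / ζ) + lambert Q (1 / (Z * ζ))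
    - lambert Q (Z * ζ)

/-- The kernel `ζ * H₂(Z, ζ)`, which is the density of `H₂(Z, ζ) dζ` with respect to the
logarithmic differential `dζ / ζ`. -/
noncomputable def logKernel (Q : ℝ) (Z ζ : ℂ) : ℂ := ζ / (ζ - Z) + regKernel Q Z ζ

section Kernel

variable {r α : ℝ} {Z ζ : ℂ}

lemma rpow_two_mul_mul_succ (hr : 0 < r) (n : ℕ) :
    ((r ^ (2 * α * (n + 1)) : ℝ) : ℂ) = ((r ^ (2 * α) : ℝ) : ℂ) ^ (n + 1) := by
  rw [Real.rpow_mul hr.le, ← Complex.ofReal_pow]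
  norm_cast

/-- The position of the two points `Z`, `ζ` needed for convergence of the four Lambert series
in the kernels. -/
structure Admissible (Q : ℝ) (Z ζ : ℂ) : Prop where
  left : Q * ‖ζ‖ < ‖Z‖
  right : Q * ‖Z‖ < ‖ζ‖
  lower : Q < ‖Z‖ * ‖ζ‖
  upper : Q * (‖Z‖ * ‖ζ‖) < 1

namespace Admissible

variable {Q : ℝ}

lemma left_ne (h : Admissible Q Z ζ) (hQ : 0 < Q) : Z ≠ 0 := by
  rintro rfl
  have := h.lower
  simp at this
  linarith

lemma right_ne (h : Admissible Q Z ζ) (hQ : 0 < Q) : ζ ≠ 0 := by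
  rintro rfl
  have := h.lower
  simp at this
  linarith

lemma norm_div_lt (h : Admissible Q Z ζ) (hQ : 0 < Q) : Q * ‖ζ / Z‖ < 1 := by
  have := norm_pos_iff.2 (h.left_ne hQ)
  rw [norm_div, ← mul_div_assoc, div_lt_one this]
  exact h.left

lemma norm_div_lt' (h : Admissible Q Z ζ) (hQ : 0 < Q) : Q * ‖Z / ζ‖ < 1 := by
  have := norm_pos_iff.2 (h.right_ne hQ)
  rw [norm_div, ← mul_div_assoc, div_lt_one this]
  exact h.right

lemma norm_inv_mul_lt (h : Admissible Q Z ζ) (hQ : 0 < Q) : Q * ‖1 / (Z * ζ)‖ < 1 := by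
  have := mul_pos (norm_pos_iff.2 (h.left_ne hQ)) (norm_pos_iff.2 (h.right_ne hQ))
  rw [norm_div, norm_mul, norm_one, mul_one_div, div_lt_one this]
  exact h.lower

lemma norm_mul_lt (h : Admissible Q Z ζ) : Q * ‖Z * ζ‖ < 1 := by
  rw [norm_mul]; exact h.upper

lemma conj_right (h : Admissible Q Z ζ) : Admissible Q Z (conj ζ) := by
  constructor <;> simp only [RCLike.norm_conj]
  exacts [h.left, h.right, h.lower, h.upper]

/-- With `q² = Q`, points of the open ring `q < ‖Z‖ < 1` are admissible with points of the
closed ring `q ≤ ‖ζ‖ ≤ 1`. -/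
lemma of_ring {q : ℝ} (hq0 : 0 < q) (hq1 : q < 1) (hZ0 : q < ‖Z‖) (hZ1 : ‖Z‖ < 1)
    (hζ0 : q ≤ ‖ζ‖) (hζ1 : ‖ζ‖ ≤ 1) : Admissible (q ^ 2) Z ζ where
  left := by nlinarith
  right := by nlinarith
  lower := by nlinarith
  upper := by
    have : ‖Z‖ * ‖ζ‖ < 1 := by nlinarith
    nlinarith [norm_nonneg Z, norm_nonneg ζ, mul_nonneg (norm_nonneg Z) (norm_nonneg ζ)]

end Admissible

lemma mul_H₂_eq (hr0 : 0 < r) (hr1 : r < 1) (hα : 0 < α)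
    (h : Admissible (r ^ (2 * α)) Z ζ) :
    ζ * H₂ r α Z ζ = logKernel (r ^ (2 * α)) Z ζ := by
  set Q := r ^ (2 * α) with hQ
  have hQ0 : 0 < Q := Real.rpow_pos_of_pos hr0 _
  have hQ1 : Q < 1 := Real.rpow_lt_one hr0.le hr1 (by positivity)
  have hZ := h.left_ne hQ0
  have hζ := h.right_ne hQ0
  have s1 := hasSum_lambert hQ0 hQ1 (h.norm_div_lt hQ0)
  have s2 := hasSum_lambert hQ0 hQ1 (h.norm_div_lt' hQ0)
  have s3 := hasSum_lambert hQ0 hQ1 (h.norm_inv_mul_lt hQ0)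
  have s4 := hasSum_lambert hQ0 hQ1 h.norm_mul_lt
  have s := ((s1.neg.add s2).add s3).sub s4
  have hs := s.tsum_eq
  unfold H₂
  simp only [rpow_two_mul_mul_succ hr0, ← hQ]
  rw [mul_add, ← tsum_mul_left, logKernel, regKernel]
  rw [show -(Z * ζ / (1 - Z * ζ)) - lambert Q (ζ / Z) + lambert Q (Z / ζ)
      + lambert Q (1 / (Z * ζ)) - lambert Q (Z * ζ) = -(Z * ζ / (1 - Z * ζ)) +
      (-lambert Q (ζ / Z) + lambert Q (Z / ζ) + lambert Q (1 / (Z * ζ)) - lambert Q (Z * ζ))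
      by ring, ← hs, ← add_assoc]
  congr 1
  · ring
  refine tsum_congr fun n => ?_
  have n1 := one_sub_pow_succ_mul_ne_zero hQ0 hQ1 (h.norm_div_lt hQ0) n
  have n2 := one_sub_pow_succ_mul_ne_zero hQ0 hQ1 (h.norm_div_lt' hQ0) n
  have n3 := one_sub_pow_succ_mul_ne_zero hQ0 hQ1 (h.norm_inv_mul_lt hQ0) n
  have n4 := one_sub_pow_succ_mul_ne_zero hQ0 hQ1 h.norm_mul_lt n
  set p := (Q : ℂ) ^ (n + 1)
  have m1 : p * ζ - Z ≠ 0 := fun h0 => n1 (by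
    rw [← mul_div_assoc, sub_eq_zero.1 h0, div_self hZ, sub_self])
  have m2 : p * Z - ζ ≠ 0 := fun h0 => n2 (by
    rw [← mul_div_assoc, sub_eq_zero.1 h0, div_self hζ, sub_self])
  have m3 : p - Z * ζ ≠ 0 := fun h0 => n3 (by
    rw [sub_eq_zero.1 h0, mul_one_div, div_self (mul_ne_zero hZ hζ), sub_self])
  have m4 : p * Z * ζ - 1 ≠ 0 := fun h0 => n4 (by linear_combination -h0)
  have e1 : ζ * (p * (1 / (p * ζ - Z))) = -(p * (ζ / Z) / (1 - p * (ζ / Z))) := by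
    rw [show 1 - p * (ζ / Z) = -(p * ζ - Z) / Z by field_simp; ring]
    field_simp
  have e2 : ζ * (p * (Z / (ζ * (p * Z - ζ)))) = -(p * (Z / ζ) / (1 - p * (Z / ζ))) := by
    rw [show 1 - p * (Z / ζ) = -(p * Z - ζ) / ζ by field_simp; ring]
    field_simp
  have e3 : ζ * (p * (1 / (ζ * (p - Z * ζ)))) =
      -(p * (1 / (Z * ζ)) / (1 - p * (1 / (Z * ζ)))) := by
    rw [show 1 - p * (1 / (Z * ζ)) = -(p - Z * ζ) / (Z * ζ) by field_simp; ring]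
    field_simp
  have e4 : ζ * (p * (Z / (p * Z * ζ - 1))) = -(p * (Z * ζ) / (1 - p * (Z * ζ))) := by
    rw [show 1 - p * (Z * ζ) = -(p * Z * ζ - 1) by ring]
    field_simp
  linear_combination e1 - e2 - e3 + e4

/-- `H₁(Z, ζ)` in terms of Lambert series. -/
lemma H₁_eq (hr0 : 0 < r) (hr1 : r < 1) (hα : 0 < α)
    (h : Admissible (r ^ (2 * α)) Z ζ) (h1 : ζ ≠ Z) (h2 : conj ζ ≠ Z) :
    H₁ r α Z ζ = 2 * (ζ / (ζ - Z) - lambert (r ^ (2 * α)) (ζ / Z) + lambert (r ^ (2 * α)) (Z / ζ))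
      - 2 * (conj ζ / (conj ζ - Z) - lambert (r ^ (2 * α)) (conj ζ / Z)
        + lambert (r ^ (2 * α)) (Z / conj ζ)) := by
  set Q := r ^ (2 * α) with hQ
  have hQ0 : 0 < Q := Real.rpow_pos_of_pos hr0 _
  have hQ1 : Q < 1 := Real.rpow_lt_one hr0.le hr1 (by positivity)
  have hZ := h.left_ne hQ0
  have hζ := h.right_ne hQ0
  have hζ' := h.conj_right.right_ne hQ0
  have s1 := hasSum_lambert hQ0 hQ1 (h.norm_div_lt hQ0)
  have s2 := hasSum_lambert hQ0 hQ1 (h.norm_div_lt' hQ0)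
  have s3 := hasSum_lambert hQ0 hQ1 (h.conj_right.norm_div_lt hQ0)
  have s4 := hasSum_lambert hQ0 hQ1 (h.conj_right.norm_div_lt' hQ0)
  have hs := (((s1.neg.add s2).add s3).sub s4).tsum_eq
  unfold H₁
  simp only [rpow_two_mul_mul_succ hr0, ← hQ]
  have key : ∀ n : ℕ, (Q : ℂ) ^ (n + 1) *
        (ζ / ((Q : ℂ) ^ (n + 1) * ζ - Z) - Z / ((Q : ℂ) ^ (n + 1) * Z - ζ)
          - conj ζ / ((Q : ℂ) ^ (n + 1) * conj ζ - Z)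
          + Z / ((Q : ℂ) ^ (n + 1) * Z - conj ζ)) =
      -((Q : ℂ) ^ (n + 1) * (ζ / Z) / (1 - (Q : ℂ) ^ (n + 1) * (ζ / Z)))
        + (Q : ℂ) ^ (n + 1) * (Z / ζ) / (1 - (Q : ℂ) ^ (n + 1) * (Z / ζ))
        + (Q : ℂ) ^ (n + 1) * (conj ζ / Z) / (1 - (Q : ℂ) ^ (n + 1) * (conj ζ / Z))
        - (Q : ℂ) ^ (n + 1) * (Z / conj ζ) / (1 - (Q : ℂ) ^ (n + 1) * (Z / conj ζ)) := by
    intro n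
    set p := (Q : ℂ) ^ (n + 1)
    have e : ∀ a b : ℂ, b ≠ 0 → p * (a / (p * a - b)) = -(p * (a / b) / (1 - p * (a / b))) := by
      intro a b hb
      rw [show 1 - p * (a / b) = -(p * a - b) / b by field_simp; ring]
      rcases eq_or_ne (p * a - b) 0 with h0 | h0
      · simp [h0]
      · field_simp
    linear_combination e ζ Z hZ - e Z ζ hζ - e (conj ζ) Z hZ + e Z (conj ζ) hζ'
  rw [tsum_congr key, hs]
  have d1 := sub_ne_zero.2 h1
  have d2 := sub_ne_zero.2 h2
  have f1 : (ζ + Z) / (ζ - Z) = 2 * (ζ / (ζ - Z)) - 1 := by field_simp; ring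
  have f2 : (conj ζ + Z) / (conj ζ - Z) = 2 * (conj ζ / (conj ζ - Z)) - 1 := by field_simp; ring
  rw [f1, f2]
  ring

/-- On the unit circle, inversion in the circle turns the four Lambert series of the kernel into
an odd function of the conjugation, up to the constant `1`. -/
lemma logKernel_of_norm_eq_one {Q : ℝ} (hζ : ‖ζ‖ = 1) (h2 : conj ζ ≠ Z) :
    logKernel Q Z ζ = (ζ / (ζ - Z) - lambert Q (ζ / Z) + lambert Q (Z / ζ))
      - (conj ζ / (conj ζ - Z) - lambert Q (conj ζ / Z) + lambert Q (Z / conj ζ)) + 1 := by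
  have hm : ζ * conj ζ = 1 := by rw [Complex.mul_conj, Complex.normSq_eq_norm_sq, hζ]; simp
  have hζ0 : ζ ≠ 0 := left_ne_zero_of_mul_eq_one hm
  have hc : conj ζ = 1 / ζ := eq_one_div_of_mul_eq_one_right hm
  have e1 : 1 / (Z * ζ) = conj ζ / Z := by rw [hc]; field_simp
  have e2 : Z * ζ = Z / conj ζ := by rw [hc]; field_simp
  have hd := sub_ne_zero.2 h2
  have e3 : Z * ζ / (1 - Z * ζ) = conj ζ / (conj ζ - Z) - 1 := by
    have : 1 - Z * ζ = ζ * (conj ζ - Z) := by linear_combination -hm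
    rw [this]
    field_simp
    ring
  rw [logKernel, regKernel, e3, e1, e2]
  ring

/-- On the inner circle `‖ζ‖² = Q` the reflection `ζ ↦ Q / ζ` shifts the Lambert series by one
term, so that the kernel is an odd function of the conjugation. -/
lemma logKernel_of_norm_sq_eq {Q : ℝ} (hQ0 : 0 < Q) (hQ1 : Q < 1) (h : Admissible Q Z ζ)
    (hζ : ‖ζ‖ ^ 2 = Q) (h2 : conj ζ ≠ Z) :
    logKernel Q Z ζ = (ζ / (ζ - Z) - lambert Q (ζ / Z) + lambert Q (Z / ζ))
      - (conj ζ / (conj ζ - Z) - lambert Q (conj ζ / Z) + lambert Q (Z / conj ζ)) := by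
  have hm : ζ * conj ζ = Q := by rw [Complex.mul_conj, Complex.normSq_eq_norm_sq, hζ]
  have hZ := h.left_ne hQ0
  have hζ0 := h.right_ne hQ0
  have hc0 := h.conj_right.right_ne hQ0
  have l1 := lambert_mul hQ0 hQ1 (h.norm_inv_mul_lt hQ0)
  have l2 := lambert_mul hQ0 hQ1 (h.conj_right.norm_div_lt' hQ0)
  have e1 : (Q : ℂ) * (1 / (Z * ζ)) = conj ζ / Z := by rw [← hm]; field_simp
  have e2 : (Q : ℂ) * (Z / conj ζ) = Z * ζ := by rw [← hm]; field_simp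
  have n1 : 1 - Z * ζ ≠ 0 := by
    have := one_sub_pow_succ_mul_ne_zero hQ0 hQ1 (h.conj_right.norm_div_lt' hQ0) 0
    rwa [zero_add, pow_one, e2] at this
  rw [e1] at l1
  rw [e2] at l2
  have hd := sub_ne_zero.2 h2
  have e3 : conj ζ / Z / (1 - conj ζ / Z) = - (conj ζ / (conj ζ - Z)) := by
    rw [show 1 - conj ζ / Z = -(conj ζ - Z) / Z by field_simp; ring]
    field_simp
  rw [e3] at l1
  rw [logKernel, regKernel]
  linear_combination -l1 - l2

/-- The kernel is regular at each admissible `ζ`, apart from its principal part. -/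
lemma differentiableAt_regKernel {Q : ℝ} (hQ0 : 0 < Q) (hQ1 : Q < 1) (h : Admissible Q Z ζ)
    (h1 : Z * ζ ≠ 1) : DifferentiableAt ℂ (regKernel Q Z) ζ := by
  have hZ := h.left_ne hQ0
  have hζ := h.right_ne hQ0
  have d1 : DifferentiableAt ℂ (fun x => lambert Q (x / Z)) ζ :=
    DifferentiableAt.comp (f := fun x => x / Z) ζ
      (differentiableAt_lambert hQ0 hQ1 (h.norm_div_lt hQ0)) (by fun_prop)
  have d2 : DifferentiableAt ℂ (fun x => lambert Q (Z / x)) ζ :=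
    DifferentiableAt.comp (f := fun x => Z / x) ζ
      (differentiableAt_lambert hQ0 hQ1 (h.norm_div_lt' hQ0))
      (DifferentiableAt.div (by fun_prop) (by fun_prop) hζ)
  have d3 : DifferentiableAt ℂ (fun x => lambert Q (1 / (Z * x))) ζ :=
    DifferentiableAt.comp (f := fun x => 1 / (Z * x)) ζ
      (differentiableAt_lambert hQ0 hQ1 (h.norm_inv_mul_lt hQ0))
      (DifferentiableAt.div (by fun_prop) (by fun_prop) (mul_ne_zero hZ hζ))
  have d4 : DifferentiableAt ℂ (fun x => lambert Q (Z * x)) ζ :=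
    DifferentiableAt.comp (f := fun x => Z * x) ζ
      (differentiableAt_lambert hQ0 hQ1 h.norm_mul_lt) (by fun_prop)
  have d5 : DifferentiableAt ℂ (fun x => Z * x / (1 - Z * x)) ζ :=
    DifferentiableAt.div (by fun_prop) (by fun_prop) (sub_ne_zero.2 h1.symm)
  exact (((d5.neg.sub d1).add d2).add d3).sub d4

end Kernel

/-! ### Contour integrals over rectangles and Green's theorem -/

/-- The integral of `f` along the boundary of the rectangle with sides `x₁`, `x₂`, `y₁`, `y₂`,
oriented counter-clockwise. -/
noncomputable def rectContour (f : ℂ → ℂ) (x₁ x₂ y₁ y₂ : ℝ) : ℂ :=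
  (∫ x in x₁..x₂, f (x + y₁ * Complex.I)) - (∫ x in x₁..x₂, f (x + y₂ * Complex.I))
    + Complex.I * (∫ y in y₁..y₂, f (x₂ + y * Complex.I))
    - Complex.I * ∫ y in y₁..y₂, f (x₁ + y * Complex.I)

/-- The open rectangle `(x₁, x₂) × (y₁, y₂)`. -/
def openRect (x₁ x₂ y₁ y₂ : ℝ) : Set ℂ := Set.Ioo x₁ x₂ ×ℂ Set.Ioo y₁ y₂

/-- The closed rectangle `[x₁, x₂] × [y₁, y₂]`. -/
def closedRect (x₁ x₂ y₁ y₂ : ℝ) : Set ℂ := Set.Icc x₁ x₂ ×ℂ Set.Icc y₁ y₂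

/-- The boundary of a rectangle. -/
def rectFrontier (x₁ x₂ y₁ y₂ : ℝ) : Set ℂ := closedRect x₁ x₂ y₁ y₂ \ openRect x₁ x₂ y₁ y₂

section Rect

variable {x₁ x₂ y₁ y₂ : ℝ}

lemma mem_openRect {s : ℂ} :
    s ∈ openRect x₁ x₂ y₁ y₂ ↔ (x₁ < s.re ∧ s.re < x₂) ∧ y₁ < s.im ∧ s.im < y₂ := Iff.rfl

lemma mem_closedRect {s : ℂ} :
    s ∈ closedRect x₁ x₂ y₁ y₂ ↔ (x₁ ≤ s.re ∧ s.re ≤ x₂) ∧ y₁ ≤ s.im ∧ s.im ≤ y₂ := Iff.rfl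

lemma openRect_subset_closedRect : openRect x₁ x₂ y₁ y₂ ⊆ closedRect x₁ x₂ y₁ y₂ :=
  fun _ h => ⟨⟨h.1.1.le, h.1.2.le⟩, h.2.1.le, h.2.2.le⟩

lemma isOpen_openRect : IsOpen (openRect x₁ x₂ y₁ y₂) := isOpen_Ioo.reProdIm isOpen_Ioo

lemma isCompact_closedRect : IsCompact (closedRect x₁ x₂ y₁ y₂) :=
  isCompact_Icc.reProdIm isCompact_Icc

lemma convex_closedRect : Convex ℝ (closedRect x₁ x₂ y₁ y₂) :=
  ((convex_Icc x₁ x₂).linear_preimage Complex.reLm).inter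
    ((convex_Icc y₁ y₂).linear_preimage Complex.imLm)

lemma bottom_mem_rectFrontier (hy : y₁ ≤ y₂) {x : ℝ} (h : x ∈ Set.Icc x₁ x₂) :
    (x + y₁ * Complex.I : ℂ) ∈ rectFrontier x₁ x₂ y₁ y₂ := by
  refine ⟨?_, fun h' => ?_⟩
  · simpa [mem_closedRect, hy] using h
  · simp [mem_openRect] at h'

lemma top_mem_rectFrontier (hy : y₁ ≤ y₂) {x : ℝ} (h : x ∈ Set.Icc x₁ x₂) :
    (x + y₂ * Complex.I : ℂ) ∈ rectFrontier x₁ x₂ y₁ y₂ := by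
  refine ⟨?_, fun h' => ?_⟩
  · simpa [mem_closedRect, hy] using h
  · simp [mem_openRect] at h'

lemma right_mem_rectFrontier (hx : x₁ ≤ x₂) {y : ℝ} (h : y ∈ Set.Icc y₁ y₂) :
    (x₂ + y * Complex.I : ℂ) ∈ rectFrontier x₁ x₂ y₁ y₂ := by
  refine ⟨?_, fun h' => ?_⟩
  · simpa [mem_closedRect, hx] using h
  · simp [mem_openRect] at h'

lemma left_mem_rectFrontier (hx : x₁ ≤ x₂) {y : ℝ} (h : y ∈ Set.Icc y₁ y₂) :
    (x₁ + y * Complex.I : ℂ) ∈ rectFrontier x₁ x₂ y₁ y₂ := by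
  refine ⟨?_, fun h' => ?_⟩
  · simpa [mem_closedRect, hx] using h
  · simp [mem_openRect] at h'

lemma rectContour_congr (hx : x₁ ≤ x₂) (hy : y₁ ≤ y₂) {f g : ℂ → ℂ}
    (h : Set.EqOn f g (rectFrontier x₁ x₂ y₁ y₂)) :
    rectContour f x₁ x₂ y₁ y₂ = rectContour g x₁ x₂ y₁ y₂ := by
  have key : ∀ (a b : ℝ) (γ : ℝ → ℂ), a ≤ b →
      (∀ t ∈ Set.Icc a b, γ t ∈ rectFrontier x₁ x₂ y₁ y₂) →
      ∫ t in a..b, f (γ t) = ∫ t in a..b, g (γ t) := by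
    intro a b γ hab hm
    refine intervalIntegral.integral_congr fun t ht => h (hm t ?_)
    rwa [Set.uIcc_of_le hab] at ht
  unfold rectContour
  rw [key x₁ x₂ _ hx fun t ht => bottom_mem_rectFrontier hy ht,
    key x₁ x₂ _ hx fun t ht => top_mem_rectFrontier hy ht,
    key y₁ y₂ _ hy fun t ht => right_mem_rectFrontier hx ht,
    key y₁ y₂ _ hy fun t ht => left_mem_rectFrontier hx ht]

/-- A function continuous on the boundary of a rectangle is continuous on each side. -/
lemma continuousOn_sides (hx : x₁ ≤ x₂) (hy : y₁ ≤ y₂) {f : ℂ → ℂ}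
    (h : ContinuousOn f (rectFrontier x₁ x₂ y₁ y₂)) :
    (ContinuousOn (fun x : ℝ => f (x + y₁ * Complex.I)) (Set.uIcc x₁ x₂) ∧
      ContinuousOn (fun x : ℝ => f (x + y₂ * Complex.I)) (Set.uIcc x₁ x₂)) ∧
    ContinuousOn (fun y : ℝ => f (x₁ + y * Complex.I)) (Set.uIcc y₁ y₂) ∧
      ContinuousOn (fun y : ℝ => f (x₂ + y * Complex.I)) (Set.uIcc y₁ y₂) := by
  rw [Set.uIcc_of_le hx, Set.uIcc_of_le hy]
  refine ⟨⟨?_, ?_⟩, ?_, ?_⟩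
  · exact h.comp (by fun_prop) fun t ht => bottom_mem_rectFrontier hy ht
  · exact h.comp (by fun_prop) fun t ht => top_mem_rectFrontier hy ht
  · exact h.comp (by fun_prop) fun t ht => left_mem_rectFrontier hx ht
  · exact h.comp (by fun_prop) fun t ht => right_mem_rectFrontier hx ht

lemma rectContour_add (hx : x₁ ≤ x₂) (hy : y₁ ≤ y₂) {f g : ℂ → ℂ}
    (hf : ContinuousOn f (rectFrontier x₁ x₂ y₁ y₂))
    (hg : ContinuousOn g (rectFrontier x₁ x₂ y₁ y₂)) :
    rectContour (fun s => f s + g s) x₁ x₂ y₁ y₂ =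
      rectContour f x₁ x₂ y₁ y₂ + rectContour g x₁ x₂ y₁ y₂ := by
  obtain ⟨⟨f1, f2⟩, f3, f4⟩ := continuousOn_sides hx hy hf
  obtain ⟨⟨g1, g2⟩, g3, g4⟩ := continuousOn_sides hx hy hg
  unfold rectContour
  rw [intervalIntegral.integral_add f1.intervalIntegrable g1.intervalIntegrable,
    intervalIntegral.integral_add f2.intervalIntegrable g2.intervalIntegrable,
    intervalIntegral.integral_add f3.intervalIntegrable g3.intervalIntegrable,
    intervalIntegral.integral_add f4.intervalIntegrable g4.intervalIntegrable]
  ring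

lemma rectContour_const_mul (c : ℂ) (f : ℂ → ℂ) :
    rectContour (fun s => c * f s) x₁ x₂ y₁ y₂ = c * rectContour f x₁ x₂ y₁ y₂ := by
  unfold rectContour
  simp only [intervalIntegral.integral_const_mul]
  ring

/-- Dominated convergence on the boundary of a rectangle. -/
lemma tendsto_rectContour (hx : x₁ ≤ x₂) (hy : y₁ ≤ y₂) {l : Filter ℝ} [l.IsCountablyGenerated]
    {f : ℝ → ℂ → ℂ} {g : ℂ → ℂ} (hg : ContinuousOn g (rectFrontier x₁ x₂ y₁ y₂))
    (hf : ∀ᶠ ε in l, ContinuousOn (f ε) (rectFrontier x₁ x₂ y₁ y₂))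
    (hle : ∀ᶠ ε in l, ∀ s, ‖f ε s‖ ≤ ‖g s‖)
    (hlim : ∀ s ∈ rectFrontier x₁ x₂ y₁ y₂, Tendsto (fun ε => f ε s) l (𝓝 (g s))) :
    Tendsto (fun ε => rectContour (f ε) x₁ x₂ y₁ y₂) l (𝓝 (rectContour g x₁ x₂ y₁ y₂)) := by
  obtain ⟨⟨g1, g2⟩, g3, g4⟩ := continuousOn_sides hx hy hg
  have key : ∀ (a b : ℝ) (γ : ℝ → ℂ), a ≤ b → ContinuousOn (fun t => g (γ t)) (Set.uIcc a b) →
      (∀ᶠ ε in l, ContinuousOn (fun t => f ε (γ t)) (Set.uIcc a b)) →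
      (∀ t ∈ Set.Icc a b, γ t ∈ rectFrontier x₁ x₂ y₁ y₂) →
      Tendsto (fun ε => ∫ t in a..b, f ε (γ t)) l (𝓝 (∫ t in a..b, g (γ t))) := by
    intro a b γ hab hc hfc hm
    refine intervalIntegral.tendsto_integral_filter_of_dominated_convergence
      (fun t => ‖g (γ t)‖) ?_ ?_ hc.norm.intervalIntegrable ?_
    · filter_upwards [hfc] with ε h
      exact (h.mono Set.uIoc_subset_uIcc).aestronglyMeasurable measurableSet_uIoc
    · filter_upwards [hle] with ε h
      exact Eventually.of_forall fun t _ => h _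
    · refine Eventually.of_forall fun t ht => hlim _ (hm t ?_)
      have := Set.uIoc_subset_uIcc ht
      rwa [Set.uIcc_of_le hab] at this
  unfold rectContour
  refine ((Tendsto.sub (key x₁ x₂ _ hx g1 ?_ ?_) (key x₁ x₂ _ hx g2 ?_ ?_)).add
    ((key y₁ y₂ _ hy g4 ?_ ?_).const_mul _)).sub ((key y₁ y₂ _ hy g3 ?_ ?_).const_mul _)
  · exact hf.mono fun ε h => (continuousOn_sides hx hy h).1.1
  · exact fun t ht => bottom_mem_rectFrontier hy ht
  · exact hf.mono fun ε h => (continuousOn_sides hx hy h).1.2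
  · exact fun t ht => top_mem_rectFrontier hy ht
  · exact hf.mono fun ε h => (continuousOn_sides hx hy h).2.2
  · exact fun t ht => right_mem_rectFrontier hx ht
  · exact hf.mono fun ε h => (continuousOn_sides hx hy h).2.1
  · exact fun t ht => left_mem_rectFrontier hx ht

lemma setIntegral_openRect (hx : x₁ ≤ x₂) (hy : y₁ ≤ y₂) {g : ℂ → ℂ}
    (hg : IntegrableOn g (openRect x₁ x₂ y₁ y₂)) :
    ∫ s in openRect x₁ x₂ y₁ y₂, g s =
      ∫ x in x₁..x₂, ∫ y in y₁..y₂, g (x + y * Complex.I) := by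
  have hmp := Complex.volume_preserving_equiv_real_prod.symm
  have hme := Complex.measurableEquivRealProd.symm.measurableEmbedding
  have hpre : Complex.measurableEquivRealProd.symm ⁻¹' (openRect x₁ x₂ y₁ y₂) =
      Set.Ioo x₁ x₂ ×ˢ Set.Ioo y₁ y₂ := rfl
  rw [← hmp.setIntegral_preimage_emb hme, hpre, Measure.volume_eq_prod, setIntegral_prod]
  · rw [intervalIntegral.integral_of_le hx, integral_Ioc_eq_integral_Ioo]
    congr 1; ext x
    rw [intervalIntegral.integral_of_le hy, integral_Ioc_eq_integral_Ioo]
    congr 1; ext y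
    rw [Complex.measurableEquivRealProd_symm_apply, Complex.mk_eq_add_mul_I]
  · rw [← hmp.integrableOn_comp_preimage hme, hpre] at hg
    exact hg

/-- The complex form of Green's theorem on a rectangle. -/
theorem rectContour_eq_integral_dbar (hx : x₁ ≤ x₂) (hy : y₁ ≤ y₂) {f : ℂ → ℂ}
    (hc : ContinuousOn f (closedRect x₁ x₂ y₁ y₂))
    (hd : ∀ s ∈ openRect x₁ x₂ y₁ y₂, DifferentiableAt ℝ f s)
    (hi : IntegrableOn (dbar f) (closedRect x₁ x₂ y₁ y₂)) :
    rectContour f x₁ x₂ y₁ y₂ = 2 * Complex.I * ∫ s in openRect x₁ x₂ y₁ y₂, dbar f s := by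
  have hdb : ∀ s, Complex.I * fderiv ℝ f s 1 - fderiv ℝ f s Complex.I
      = 2 * Complex.I * dbar f s := by
    intro s
    simp only [dbar]
    linear_combination (-fderiv ℝ f s Complex.I) * Complex.I_sq
  have h := Complex.integral_boundary_rect_of_continuousOn_of_hasFDerivAt_real f (fderiv ℝ f)
    ⟨x₁, y₁⟩ ⟨x₂, y₂⟩ ?_ ?_ ?_
  · simp only [hdb, smul_eq_mul, intervalIntegral.integral_const_mul] at h
    rw [setIntegral_openRect hx hy (hi.mono_set openRect_subset_closedRect), rectContour]
    exact h
  · simpa only [Set.uIcc_of_le hx, Set.uIcc_of_le hy] using! hc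
  · intro s hs
    simp only [min_eq_left hx, max_eq_right hx, min_eq_left hy, max_eq_right hy] at hs
    exact (hd s hs).hasFDerivAt
  · simp only [smul_eq_mul, hdb, Set.uIcc_of_le hx, Set.uIcc_of_le hy]
    exact hi.const_mul _

end Rect

section Dbar

variable {f g : ℂ → ℂ} {s : ℂ}

lemma dbar_mul (hf : DifferentiableAt ℝ f s) (hg : DifferentiableAt ℝ g s) :
    dbar (fun t => f t * g t) s = dbar f s * g s + f s * dbar g s := by
  simp only [dbar, fderiv_fun_mul hf hg, add_apply, smul_apply, smul_eq_mul]
  ring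

lemma dbar_of_holomorphic (hf : DifferentiableAt ℂ f s) : dbar f s = 0 := by
  have h : fderiv ℝ f s = (fderiv ℂ f s).restrictScalars ℝ :=
    (hf.hasFDerivAt.restrictScalars ℝ).fderiv
  have h2 : fderiv ℂ f s Complex.I = Complex.I * fderiv ℂ f s 1 := by
    rw [← smul_eq_mul, ← map_smul, smul_eq_mul, mul_one]
  simp only [dbar, h, ContinuousLinearMap.coe_restrictScalars', h2]
  linear_combination (1 / 2 * fderiv ℂ f s 1) * Complex.I_sq

lemma dbar_sub_const (c : ℂ) : dbar (fun t => f t - c) s = dbar f s := by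
  simp only [dbar, fderiv_sub_const]

lemma dbar_add_const (c : ℂ) : dbar (fun t => f t + c) s = dbar f s := by
  simp only [dbar, fderiv_add_const]

lemma dbar_conj_sub (c : ℂ) : dbar (fun t => conj (t - c)) s = 1 := by
  have h : HasFDerivAt (fun t : ℂ => conj (t - c)) (Complex.conjCLE : ℂ →L[ℝ] ℂ) s :=
    HasFDerivAt.comp (f := fun t : ℂ => t - c) s (Complex.conjCLE.hasFDerivAt (x := s - c))
      ((hasFDerivAt_id s).sub_const c)
  simp only [dbar, h.fderiv]
  simp
  norm_num

end Dbar

/-! ### The Cauchy-Pompeiu formula on rectangles -/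

section Winding

lemma log_sub_log_neg_of_im_pos {u : ℂ} (hu : 0 < u.im) :
    Complex.log u - Complex.log (-u) = Real.pi * Complex.I := by
  simp only [Complex.log, norm_neg, Complex.arg_neg_eq_arg_sub_pi_of_im_pos hu]
  push_cast; ring

lemma log_sub_log_neg_of_im_neg {u : ℂ} (hu : u.im < 0) :
    Complex.log u - Complex.log (-u) = -(Real.pi * Complex.I) := by
  simp only [Complex.log, norm_neg, Complex.arg_neg_eq_arg_add_pi_of_im_neg hu]
  push_cast; ring

/-- A path integral of `du / u` is a difference of logarithms, where the logarithm may be that of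
any fixed multiple `c * u` staying off the cut. -/
lemma integral_inv_path {γ : ℝ → ℂ} {d : ℂ} (c : ℂ) (hc : c ≠ 0) (a b : ℝ)
    (hγ : ∀ t, HasDerivAt γ d t)
    (hs : ∀ t ∈ Set.uIcc a b, c * γ t ∈ Complex.slitPlane) :
    d * ∫ t in a..b, 1 / γ t = Complex.log (c * γ b) - Complex.log (c * γ a) := by
  have hne : ∀ t ∈ Set.uIcc a b, γ t ≠ 0 := fun t ht =>
    right_ne_zero_of_mul (Complex.slitPlane_ne_zero (hs t ht))
  have hcont : Continuous γ := continuous_iff_continuousAt.2 fun t => (hγ t).continuousAt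
  rw [← intervalIntegral.integral_const_mul]
  refine intervalIntegral.integral_eq_sub_of_hasDerivAt (f := fun t => Complex.log (c * γ t))
    (fun t ht => ?_) ?_
  · have h := ((hγ t).const_mul c).clog_real (hs t ht)
    have := hne t ht
    convert! h using 1
    field_simp
  · refine ContinuousOn.intervalIntegrable ?_
    exact continuousOn_const.mul (continuousOn_const.div hcont.continuousOn hne)

variable {x₁ x₂ y₁ y₂ : ℝ} {s₀ : ℂ}

lemma rectContour_inv_sub (h : s₀ ∈ openRect x₁ x₂ y₁ y₂) :
    rectContour (fun s => 1 / (s - s₀)) x₁ x₂ y₁ y₂ = 2 * Real.pi * Complex.I := by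
  obtain ⟨⟨h1, h2⟩, h3, h4⟩ := mem_openRect.1 h
  have hor : ∀ y : ℝ, ∀ t : ℝ, HasDerivAt (fun x : ℝ => (x + y * Complex.I - s₀ : ℂ)) 1 t :=
    fun y t => (((hasDerivAt_id t).ofReal_comp).add_const _).sub_const _
  have ver : ∀ x : ℝ, ∀ t : ℝ,
      HasDerivAt (fun y : ℝ => (x + y * Complex.I - s₀ : ℂ)) Complex.I t := fun x t => by
    have := ((((hasDerivAt_id t).ofReal_comp).mul_const Complex.I).const_add (x : ℂ)).sub_const s₀
    simpa using this
  have b := integral_inv_path 1 one_ne_zero x₁ x₂ (hor y₁) fun t _ => by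
    rw [Complex.mem_slitPlane_iff]; right; simp; linarith
  have t := integral_inv_path 1 one_ne_zero x₁ x₂ (hor y₂) fun t _ => by
    rw [Complex.mem_slitPlane_iff]; right; simp; linarith
  have r := integral_inv_path 1 one_ne_zero y₁ y₂ (ver x₂) fun t _ => by
    rw [Complex.mem_slitPlane_iff]; left; simp; linarith
  -- The left side crosses the cut of the logarithm, so `log (-u)` is used there.
  have l := integral_inv_path (-1) (neg_ne_zero.2 one_ne_zero) y₁ y₂ (ver x₁) fun t _ => by
    rw [Complex.mem_slitPlane_iff]; left; simp; linarith
  have j1 := log_sub_log_neg_of_im_pos (u := (x₁ + y₂ * Complex.I - s₀ : ℂ)) (by simp; linarith)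
  have j2 := log_sub_log_neg_of_im_neg (u := (x₁ + y₁ * Complex.I - s₀ : ℂ)) (by simp; linarith)
  simp only [one_mul, neg_one_mul] at b t r l
  rw [rectContour, b, t, r, l]
  linear_combination j1 - j2

end Winding

section Pompeiu

/-- A mollified version of `1 / u`: smooth on the whole plane, dominated by `1 / u`, and tending
to `1 / u` as `ε ↓ 0`. -/
noncomputable def invMollified (ε : ℝ) (u : ℂ) : ℂ := conj u / (u * conj u + ε)

variable {ε : ℝ} {u s s₀ : ℂ}

lemma mul_conj_add_eq (ε : ℝ) (u : ℂ) : u * conj u + ε = ((‖u‖ ^ 2 + ε : ℝ) : ℂ) := by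
  rw [Complex.mul_conj, Complex.normSq_eq_norm_sq]; push_cast; ring

lemma mul_conj_add_ne_zero (hε : 0 < ε) (u : ℂ) : u * conj u + ε ≠ 0 := by
  rw [mul_conj_add_eq]
  exact_mod_cast (by positivity : ‖u‖ ^ 2 + ε ≠ 0)

lemma norm_mul_conj_add (hε : 0 < ε) (u : ℂ) : ‖u * conj u + ε‖ = ‖u‖ ^ 2 + ε := by
  rw [mul_conj_add_eq, Complex.norm_real, Real.norm_of_nonneg (by positivity)]

lemma norm_invMollified_le (hε : 0 < ε) (u : ℂ) : ‖invMollified ε u‖ ≤ ‖1 / u‖ := by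
  rw [invMollified, norm_div, norm_mul_conj_add hε, RCLike.norm_conj, norm_div, norm_one]
  rcases eq_or_ne u 0 with rfl | hu
  · simp
  have := norm_pos_iff.2 hu
  rw [div_le_div_iff₀ (by positivity) this]
  nlinarith

lemma tendsto_invMollified (hu : u ≠ 0) :
    Tendsto (fun ε => invMollified ε u) (𝓝[>] 0) (𝓝 (1 / u)) := by
  have hc : conj u ≠ 0 := (map_ne_zero _).2 hu
  have h : ContinuousAt (fun ε : ℝ => invMollified ε u) 0 := by
    unfold invMollified
    refine ContinuousAt.div (by fun_prop) (by fun_prop) ?_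
    simpa using hu
  have h2 := h.tendsto.mono_left (nhdsWithin_le_nhds (s := Set.Ioi (0 : ℝ)))
  have e : invMollified 0 u = 1 / u := by
    simp only [invMollified, Complex.ofReal_zero, add_zero]
    field_simp
  rwa [e] at h2

lemma differentiable_invMollified (hε : 0 < ε) :
    Differentiable ℝ fun s => invMollified ε (s - s₀) := by
  intro s
  have hc : DifferentiableAt ℝ (fun s : ℂ => conj (s - s₀)) s :=
    Complex.conjCLE.differentiableAt.comp s (differentiableAt_id.sub_const s₀)
  have hn : DifferentiableAt ℝ (fun s : ℂ => (s - s₀) * conj (s - s₀) + ε) s :=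
    ((differentiableAt_id.sub_const s₀).mul hc).add_const _
  exact hc.fun_mul (hn.fun_inv (mul_conj_add_ne_zero hε _))

/-- The Wirtinger derivative of the mollified pole, an approximate identity. -/
lemma dbar_invMollified (hε : 0 < ε) :
    dbar (fun s => invMollified ε (s - s₀)) s
      = ε / ((s - s₀) * conj (s - s₀) + ε) ^ 2 := by
  have hc : DifferentiableAt ℝ (fun s : ℂ => conj (s - s₀)) s :=
    Complex.conjCLE.differentiableAt.comp s (differentiableAt_id.sub_const s₀)
  have hs : DifferentiableAt ℝ (fun s : ℂ => s - s₀) s := differentiableAt_id.sub_const s₀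
  have hn : DifferentiableAt ℝ (fun s : ℂ => (s - s₀) * conj (s - s₀) + ε) s :=
    (hs.mul hc).add_const _
  have hne := mul_conj_add_ne_zero hε (s - s₀)
  -- Differentiate the identity `invMollified ε u * (u * conj u + ε) = conj u`.
  have h1 : (fun s => invMollified ε (s - s₀) * ((s - s₀) * conj (s - s₀) + ε))
      = fun s => conj (s - s₀) := by
    ext t
    exact div_mul_cancel₀ _ (mul_conj_add_ne_zero hε _)
  have h2 := dbar_mul (differentiable_invMollified (s₀ := s₀) hε s) hn
  have h3 : dbar (fun s : ℂ => s - s₀) s = 0 :=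
    dbar_of_holomorphic (differentiableAt_id.sub_const s₀)
  rw [h1, dbar_conj_sub, dbar_add_const, dbar_mul hs hc, h3, dbar_conj_sub] at h2
  simp only [invMollified] at h2 ⊢
  field_simp at h2 ⊢
  linear_combination -h2

lemma integrableOn_inv_sub {K : Set ℂ} (hK : IsCompact K) (s₀ : ℂ) :
    IntegrableOn (fun s => 1 / (s - s₀)) K := by
  have h : LocallyIntegrable (fun s : ℂ => 1 / s) := by
    refine locallyIntegrable_of_norm_le_rpow (C := 1) (α := 1) (by simp) (by simp) ?_ ?_
    · refine Eventually.of_forall fun s => ?_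
      rw [Real.rpow_neg_one, norm_div, norm_one, one_div, one_mul]
    · exact (measurable_const.div measurable_id).aestronglyMeasurable
  have h2 := h.integrableOn_isCompact 
    (hK.image (f := fun s => s - s₀) (by fun_prop))
  have hmp := measurePreserving_sub_right (volume : Measure ℂ) s₀
  have hme := (Homeomorph.subRight s₀).measurableEmbedding
  have h3 := (hmp.integrableOn_comp_preimage hme).2 h2
  exact h3.mono_set fun x hx => ⟨x, hx, rfl⟩

lemma continuousOn_fderiv_of_contDiffOn {F : ℂ → ℂ} {U : Set ℂ} (hU : IsOpen U)
    (hF : ContDiffOn ℝ 1 F U) : ContinuousOn (fderiv ℝ F) U :=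
  hF.continuousOn_fderiv_of_isOpen hU le_rfl

lemma continuousOn_dbar {F : ℂ → ℂ} {U : Set ℂ} (hU : IsOpen U)
    (hF : ContDiffOn ℝ 1 F U) : ContinuousOn (dbar F) U := by
  have h := continuousOn_fderiv_of_contDiffOn hU hF
  unfold dbar
  exact continuousOn_const.mul ((h.clm_apply continuousOn_const).add
    (continuousOn_const.mul (h.clm_apply continuousOn_const)))

lemma differentiableAt_of_contDiffOn {F : ℂ → ℂ} {U : Set ℂ} (hU : IsOpen U)
    (hF : ContDiffOn ℝ 1 F U) (hs : s ∈ U) : DifferentiableAt ℝ F s :=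
  (hF.differentiableOn one_ne_zero).differentiableAt (hU.mem_nhds hs)

variable {x₁ x₂ y₁ y₂ : ℝ}

/-- The Cauchy-Pompeiu formula with the value at the pole subtracted: the integrand on the
boundary then comes from a function with a bounded singularity, and no residue appears. -/
lemma rectContour_sub_div_sub {F : ℂ → ℂ} {U : Set ℂ} (hU : IsOpen U) (hF : ContDiffOn ℝ 1 F U)
    (hK : closedRect x₁ x₂ y₁ y₂ ⊆ U) (h : s₀ ∈ openRect x₁ x₂ y₁ y₂) :
    rectContour (fun s => (F s - F s₀) * (1 / (s - s₀))) x₁ x₂ y₁ y₂ =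
      2 * Complex.I * ∫ s in openRect x₁ x₂ y₁ y₂, dbar F s * (1 / (s - s₀)) := by
  have hx : x₁ ≤ x₂ := (h.1.1.trans h.1.2).le
  have hy : y₁ ≤ y₂ := (h.2.1.trans h.2.2).le
  have hs0 : s₀ ∈ closedRect x₁ x₂ y₁ y₂ := openRect_subset_closedRect h
  have hdF : ∀ s ∈ closedRect x₁ x₂ y₁ y₂, DifferentiableAt ℝ F s := fun s hs =>
    differentiableAt_of_contDiffOn hU hF (hK hs)
  have hcF : ContinuousOn F (closedRect x₁ x₂ y₁ y₂) := hF.continuousOn.mono hK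
  have hcd : ContinuousOn (dbar F) (closedRect x₁ x₂ y₁ y₂) := (continuousOn_dbar hU hF).mono hK
  obtain ⟨C, hC⟩ := isCompact_closedRect.exists_bound_of_continuousOn
    ((continuousOn_fderiv_of_contDiffOn hU hF).mono hK)
  obtain ⟨D, hD⟩ := isCompact_closedRect.exists_bound_of_continuousOn hcd
  have hLip : ∀ s ∈ closedRect x₁ x₂ y₁ y₂, ‖F s - F s₀‖ ≤ C * ‖s - s₀‖ := fun s hs =>
    convex_closedRect.norm_image_sub_le_of_norm_fderiv_le hdF hC hs0 hs
  have hne : ∀ s ∈ rectFrontier x₁ x₂ y₁ y₂, s - s₀ ≠ 0 := fun s hs h0 =>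
    hs.2 (by rwa [sub_eq_zero.1 h0])
  have hcm : ∀ ε > 0, Continuous fun s => invMollified ε (s - s₀) := fun ε hε =>
    (differentiable_invMollified hε).continuous
  have hdb : ∀ ε > 0, ∀ s ∈ closedRect x₁ x₂ y₁ y₂,
      dbar (fun s => (F s - F s₀) * invMollified ε (s - s₀)) s =
        dbar F s * invMollified ε (s - s₀)
          + (F s - F s₀) * (ε / ((s - s₀) * conj (s - s₀) + ε) ^ 2) := by
    intro ε hε s hs
    rw [dbar_mul ((hdF s hs).sub_const _) (differentiable_invMollified hε s), dbar_sub_const,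
      dbar_invMollified hε]
  have hcdb : ∀ ε > 0, ContinuousOn (fun s => dbar F s * invMollified ε (s - s₀)
          + (F s - F s₀) * (ε / ((s - s₀) * conj (s - s₀) + ε) ^ 2))
          (closedRect x₁ x₂ y₁ y₂) := by
    intro ε hε
    have h1 : Continuous fun s : ℂ => (ε : ℂ) / ((s - s₀) * conj (s - s₀) + ε) ^ 2 := by
      refine continuous_const.div ?_ fun s => pow_ne_zero 2 (mul_conj_add_ne_zero hε _)
      have : Continuous fun s : ℂ => conj (s - s₀) :=
        Complex.continuous_conj.comp (continuous_id.sub continuous_const)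
      fun_prop
    exact (hcd.mul (hcm ε hε).continuousOn).add
      ((hcF.sub continuousOn_const).mul h1.continuousOn)
  have hgreen : ∀ ε > 0,
      rectContour (fun s => (F s - F s₀) * invMollified ε (s - s₀)) x₁ x₂ y₁ y₂ =
        2 * Complex.I * ∫ s in openRect x₁ x₂ y₁ y₂, (dbar F s * invMollified ε (s - s₀)
          + (F s - F s₀) * (ε / ((s - s₀) * conj (s - s₀) + ε) ^ 2)) := by
    intro ε hε
    rw [rectContour_eq_integral_dbar hx hy]
    · congr 1
      exact setIntegral_congr_fun isOpen_openRect.measurableSet fun s hs =>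
        hdb ε hε s (openRect_subset_closedRect hs)
    · exact (hcF.sub continuousOn_const).mul (hcm ε hε).continuousOn
    · exact fun s hs => ((hdF s (openRect_subset_closedRect hs)).sub_const _).mul
        (differentiable_invMollified hε s)
    · refine ((hcdb ε hε).congr fun s hs => hdb ε hε s hs).integrableOn_compact
        isCompact_closedRect
  have hlim1 : Tendsto (fun ε => rectContour (fun s => (F s - F s₀) * invMollified ε (s - s₀))
      x₁ x₂ y₁ y₂) (𝓝[>] 0)
      (𝓝 (rectContour (fun s => (F s - F s₀) * (1 / (s - s₀))) x₁ x₂ y₁ y₂)) := by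
    have hcF' := (hcF.sub (continuousOn_const (c := F s₀))).mono
      (Set.sdiff_subset (t := openRect x₁ x₂ y₁ y₂))
    refine tendsto_rectContour hx hy (hcF'.mul (continuousOn_const.div (by fun_prop) hne)) ?_ ?_ ?_
    · filter_upwards [self_mem_nhdsWithin] with ε hε
      exact hcF'.mul (hcm ε hε).continuousOn
    · filter_upwards [self_mem_nhdsWithin] with ε hε s
      rw [norm_mul, norm_mul]
      gcongr
      exact norm_invMollified_le hε _
    · exact fun s hs => (tendsto_invMollified (hne s hs)).const_mul _
  have hlim2 : Tendsto (fun ε : ℝ => ∫ s in openRect x₁ x₂ y₁ y₂,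
        (dbar F s * invMollified ε (s - s₀)
          + (F s - F s₀) * (ε / ((s - s₀) * conj (s - s₀) + ε) ^ 2))) (𝓝[>] 0)
      (𝓝 (∫ s in openRect x₁ x₂ y₁ y₂, dbar F s * (1 / (s - s₀)))) := by
    refine tendsto_integral_filter_of_dominated_convergence
      (fun s => (D + C) * ‖1 / (s - s₀)‖) ?_ ?_ ?_ ?_
    · filter_upwards [self_mem_nhdsWithin] with ε hε
      exact ((hcdb ε hε).mono openRect_subset_closedRect).aestronglyMeasurable
        isOpen_openRect.measurableSet
    · filter_upwards [self_mem_nhdsWithin] with ε hε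
      have hε : 0 < ε := hε
      refine (ae_restrict_iff' isOpen_openRect.measurableSet).2 (Eventually.of_forall fun s hs => ?_)
      have hs := openRect_subset_closedRect hs
      have hC0 : 0 ≤ C := (norm_nonneg _).trans (hC s hs)
      rw [add_mul]
      refine (norm_add_le _ _).trans (add_le_add ?_ ?_)
      · rw [norm_mul]
        exact mul_le_mul (hD s hs) (norm_invMollified_le hε _) (norm_nonneg _)
          ((norm_nonneg _).trans (hD s hs))
      · rw [norm_mul, norm_div, norm_pow, norm_mul_conj_add hε, Complex.norm_real,
          Real.norm_of_nonneg hε.le, norm_div, norm_one]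
        rcases eq_or_ne s s₀ with rfl | hne
        · simp
        have hpos := norm_pos_iff.2 (sub_ne_zero.2 hne)
        refine (mul_le_mul_of_nonneg_right (hLip s hs) (by positivity)).trans ?_
        rw [mul_assoc]
        refine mul_le_mul_of_nonneg_left ?_ hC0
        rw [← mul_div_assoc, div_le_div_iff₀ (by positivity) hpos]
        nlinarith [sq_nonneg (‖s - s₀‖ ^ 2), sq_nonneg ε, mul_pos (pow_pos hpos 2) hε]
    · exact ((integrableOn_inv_sub isCompact_closedRect s₀).mono_set
        openRect_subset_closedRect).norm.const_mul _
    · have hae : ∀ᵐ s ∂(volume : Measure ℂ), s ≠ s₀ := by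
        simp [ae_iff]
      refine ae_restrict_of_ae (hae.mono fun s hs => ?_)
      have h0 := sub_ne_zero.2 hs
      have hc : conj (s - s₀) ≠ 0 := (map_ne_zero _).2 h0
      have h2 : Tendsto (fun ε : ℝ => (ε : ℂ) / ((s - s₀) * conj (s - s₀) + ε) ^ 2) (𝓝[>] 0)
          (𝓝 0) := by
        have hca : ContinuousAt (fun ε : ℝ => (ε : ℂ) / ((s - s₀) * conj (s - s₀) + ε) ^ 2) 0 := by
          refine ContinuousAt.div (by fun_prop) (by fun_prop) ?_
          rw [Complex.ofReal_zero, add_zero]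
          exact pow_ne_zero 2 (mul_ne_zero h0 hc)
        have := hca.tendsto.mono_left (nhdsWithin_le_nhds (s := Set.Ioi (0 : ℝ)))
        simpa using this
      have h3 := ((tendsto_invMollified h0).const_mul (dbar F s)).add
        (h2.const_mul (F s - F s₀))
      rwa [mul_zero, add_zero] at h3
  refine tendsto_nhds_unique hlim1 ((hlim2.const_mul _).congr' ?_)
  filter_upwards [self_mem_nhdsWithin] with ε hε using (hgreen ε hε).symm

/-- The Cauchy-Pompeiu formula on a rectangle. -/
theorem rectContour_div_sub {F : ℂ → ℂ} {U : Set ℂ} (hU : IsOpen U) (hF : ContDiffOn ℝ 1 F U)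
    (hK : closedRect x₁ x₂ y₁ y₂ ⊆ U) (h : s₀ ∈ openRect x₁ x₂ y₁ y₂) :
    rectContour (fun s => F s * (1 / (s - s₀))) x₁ x₂ y₁ y₂ =
      2 * Real.pi * Complex.I * F s₀ +
        2 * Complex.I * ∫ s in openRect x₁ x₂ y₁ y₂, dbar F s * (1 / (s - s₀)) := by
  have hx : x₁ ≤ x₂ := (h.1.1.trans h.1.2).le
  have hy : y₁ ≤ y₂ := (h.2.1.trans h.2.2).le
  have hne : ∀ s ∈ rectFrontier x₁ x₂ y₁ y₂, s - s₀ ≠ 0 := fun s hs h0 =>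
    hs.2 (by rwa [sub_eq_zero.1 h0])
  have hinv : ContinuousOn (fun s => 1 / (s - s₀)) (rectFrontier x₁ x₂ y₁ y₂) :=
    continuousOn_const.div (by fun_prop) hne
  have hcF : ContinuousOn F (rectFrontier x₁ x₂ y₁ y₂) :=
    hF.continuousOn.mono (Set.sdiff_subset.trans hK)
  have e : (fun s => F s * (1 / (s - s₀))) =
      fun s => (F s - F s₀) * (1 / (s - s₀)) + F s₀ * (1 / (s - s₀)) := by
    ext s; ring
  rw [e, rectContour_add (f := fun s => (F s - F s₀) * (1 / (s - s₀)))
    (g := fun s => F s₀ * (1 / (s - s₀))) hx hy ((hcF.sub continuousOn_const).mul hinv)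
    (continuousOn_const.mul hinv), rectContour_const_mul, rectContour_inv_sub h,
    rectContour_sub_div_sub hU hF hK h]
  ring

/-- Green's theorem for the product of a `C¹` function with a holomorphic function. -/
theorem rectContour_mul_holomorphic {F A : ℂ → ℂ} {U : Set ℂ} (hU : IsOpen U)
    (hF : ContDiffOn ℝ 1 F U) (hK : closedRect x₁ x₂ y₁ y₂ ⊆ U) (hx : x₁ ≤ x₂) (hy : y₁ ≤ y₂)
    (hA : ∀ s ∈ closedRect x₁ x₂ y₁ y₂, DifferentiableAt ℂ A s) :
    rectContour (fun s => F s * A s) x₁ x₂ y₁ y₂ =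
      2 * Complex.I * ∫ s in openRect x₁ x₂ y₁ y₂, dbar F s * A s := by
  have hdF : ∀ s ∈ closedRect x₁ x₂ y₁ y₂, DifferentiableAt ℝ F s := fun s hs =>
    differentiableAt_of_contDiffOn hU hF (hK hs)
  have hcA : ContinuousOn A (closedRect x₁ x₂ y₁ y₂) := fun s hs =>
    (hA s hs).continuousAt.continuousWithinAt
  have hdb : ∀ s ∈ closedRect x₁ x₂ y₁ y₂, dbar (fun s => F s * A s) s = dbar F s * A s := by
    intro s hs
    rw [dbar_mul (hdF s hs) ((hA s hs).restrictScalars ℝ), dbar_of_holomorphic (hA s hs), mul_zero,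
      add_zero]
  rw [rectContour_eq_integral_dbar hx hy]
  · congr 1
    exact setIntegral_congr_fun isOpen_openRect.measurableSet fun s hs =>
      hdb s (openRect_subset_closedRect hs)
  · exact (hF.continuousOn.mono hK).mul hcA
  · exact fun s hs => (hdF s (openRect_subset_closedRect hs)).mul
      ((hA s (openRect_subset_closedRect hs)).restrictScalars ℝ)
  · exact ((((continuousOn_dbar hU hF).mono hK).mul hcA).congr hdb).integrableOn_compact
      isCompact_closedRect

end Pompeiu

/-! ### Logarithmic coordinates -/

section LogCoordinates

variable {s z : ℂ}

lemma argPos_exp (h0 : 0 ≤ s.im) (h1 : s.im < 2 * Real.pi) : argPos (Complex.exp s) = s.im := by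
  rw [argPos, Complex.arg_exp, toIcoMod_eq_iff]
  refine ⟨⟨h0, by simpa using h1⟩, -toIocDiv Real.two_pi_pos (-Real.pi) s.im, ?_⟩
  rw [toIocMod, neg_smul, sub_eq_add_neg]

lemma exp_log_norm_add_argPos (hz : z ≠ 0) :
    Complex.exp (Real.log ‖z‖ + argPos z * Complex.I) = z := by
  have h : (argPos z : ℂ) * Complex.I = z.arg * Complex.I
      - (toIcoDiv Real.two_pi_pos 0 z.arg : ℤ) * (2 * Real.pi * Complex.I) := by
    rw [argPos, toIcoMod]
    simp only [zsmul_eq_mul]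
    push_cast
    ring
  rw [h, ← add_sub_assoc, Complex.exp_periodic.sub_int_mul_eq, Complex.exp_add,
    ← Complex.ofReal_exp, Real.exp_log (norm_pos_iff.2 hz), Complex.norm_mul_exp_arg_mul_I]

lemma polar_exp (x t : ℝ) : polar (Real.exp x) t = Complex.exp (x + t * Complex.I) := by
  rw [polar, Complex.ofReal_exp, Complex.exp_add]

lemma polarPow_exp (a x t : ℝ) :
    polarPow a (Real.exp x) t = Complex.exp (a * (x + t * Complex.I)) := by
  rw [polarPow, ← Real.exp_mul, Complex.ofReal_exp, ← Complex.exp_add]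
  congr 1
  push_cast
  ring

lemma branchPow_exp (a : ℝ) (h0 : 0 ≤ s.im) (h1 : s.im < 2 * Real.pi) :
    branchPow a (Complex.exp s) = Complex.exp (a * s) := by
  rw [branchPow, argPos_exp h0 h1, Complex.norm_exp, polarPow_exp, Complex.re_add_im]

lemma region_eq_image_exp {r₁ r₂ a b : ℝ} (hr₁ : 0 < r₁) (hr₂ : 0 < r₂) (ha : 0 ≤ a)
    (hb : b ≤ 2 * Real.pi) :
    region r₁ r₂ a b = Complex.exp '' openRect (Real.log r₁) (Real.log r₂) a b := by
  ext z
  constructor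
  · rintro ⟨h1, h2, h3, h4⟩
    have hz : 0 < ‖z‖ := hr₁.trans h1
    refine ⟨_, ?_, exp_log_norm_add_argPos (norm_pos_iff.1 hz)⟩
    simp only [mem_openRect, Complex.add_re, Complex.add_im, Complex.re_ofReal_mul,
      Complex.im_ofReal_mul, Complex.ofReal_re, Complex.ofReal_im, Complex.I_re, Complex.I_im,
      mul_zero, add_zero, mul_one, zero_add]
    exact ⟨⟨Real.log_lt_log hr₁ h1, Real.log_lt_log hz h2⟩, h3, h4⟩
  · rintro ⟨s, hs, rfl⟩
    obtain ⟨⟨h1, h2⟩, h3, h4⟩ := mem_openRect.1 hs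
    rw [region, Set.mem_ofPred_eq, argPos_exp (ha.trans h3.le) (h4.trans_le hb), Complex.norm_exp]
    exact ⟨(Real.log_lt_iff_lt_exp hr₁).1 h1, (Real.lt_log_iff_exp_lt hr₂).1 h2, h3, h4⟩

lemma injOn_exp_openRect {x₁ x₂ y₁ y₂ : ℝ} (h0 : 0 ≤ y₁) (h1 : y₂ ≤ 2 * Real.pi) :
    Set.InjOn Complex.exp (openRect x₁ x₂ y₁ y₂) := by
  intro s hs t ht h
  obtain ⟨-, a1, a2⟩ := mem_openRect.1 hs
  obtain ⟨-, b1, b2⟩ := mem_openRect.1 ht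
  refine Complex.ext ?_ ?_
  · have := congrArg (‖·‖) h
    simpa [Complex.norm_exp] using this
  · rw [← argPos_exp (h0.trans a1.le) (a2.trans_le h1), h,
      argPos_exp (h0.trans b1.le) (b2.trans_le h1)]

/-- The derivative of the exponential as a real linear map. -/
noncomputable def expFDeriv (s : ℂ) : ℂ →L[ℝ] ℂ :=
  (ContinuousLinearMap.toSpanSingleton ℂ (Complex.exp s)).restrictScalars ℝ

lemma hasFDerivAt_exp (s : ℂ) : HasFDerivAt Complex.exp (expFDeriv s) s :=
  (Complex.hasDerivAt_exp s).hasFDerivAt.restrictScalars ℝ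

lemma expFDeriv_apply (s v : ℂ) : expFDeriv s v = v * Complex.exp s := rfl

lemma abs_det_expFDeriv (s : ℂ) : |(expFDeriv s).det| = ‖Complex.exp s‖ ^ 2 := by
  have : (expFDeriv s).det = ‖Complex.exp s‖ ^ 2 := by
    rw [ContinuousLinearMap.det, ← LinearMap.det_toMatrix Complex.basisOneI, Matrix.det_fin_two]
    simp only [LinearMap.toMatrix_apply, Complex.coe_basisOneI_repr, Complex.coe_basisOneI,
      ContinuousLinearMap.coe_coe, expFDeriv_apply]
    rw [← Complex.normSq_eq_norm_sq, Complex.normSq_apply]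
    simp
  rw [this, abs_of_nonneg (by positivity)]

variable {x₁ x₂ y₁ y₂ : ℝ}

lemma integrableOn_image_exp_iff (h0 : 0 ≤ y₁) (h1 : y₂ ≤ 2 * Real.pi) (g : ℂ → ℂ) :
    IntegrableOn g (Complex.exp '' openRect x₁ x₂ y₁ y₂) ↔
      IntegrableOn (fun s => (‖Complex.exp s‖ ^ 2 : ℝ) * g (Complex.exp s))
        (openRect x₁ x₂ y₁ y₂) := by
  rw [integrableOn_image_iff_integrableOn_abs_det_fderiv_smul volume
    isOpen_openRect.measurableSet (fun s _ => (hasFDerivAt_exp s).hasFDerivWithinAt)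
    (injOn_exp_openRect h0 h1)]
  simp only [abs_det_expFDeriv, Complex.real_smul]

lemma integral_image_exp (h0 : 0 ≤ y₁) (h1 : y₂ ≤ 2 * Real.pi) (g : ℂ → ℂ) :
    ∫ τ in Complex.exp '' openRect x₁ x₂ y₁ y₂, g τ =
      ∫ s in openRect x₁ x₂ y₁ y₂, (‖Complex.exp s‖ ^ 2 : ℝ) * g (Complex.exp s) := by
  rw [integral_image_eq_integral_abs_det_fderiv_smul volume
    isOpen_openRect.measurableSet (fun s _ => (hasFDerivAt_exp s).hasFDerivWithinAt)
    (injOn_exp_openRect h0 h1)]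
  simp only [abs_det_expFDeriv, Complex.real_smul]

lemma dbar_comp_exp {w : ℂ → ℂ} (hw : DifferentiableAt ℝ w (Complex.exp s)) :
    dbar (fun s => w (Complex.exp s)) s = conj (Complex.exp s) * dbar w (Complex.exp s) := by
  have h := (hw.hasFDerivAt.comp s (hasFDerivAt_exp s)).fderiv
  have h' : fderiv ℝ (fun s => w (Complex.exp s)) s =
    (fderiv ℝ w (Complex.exp s)).comp (expFDeriv s) := h
  have hl : ∀ v : ℂ, fderiv ℝ w (Complex.exp s) v =
      v.re * fderiv ℝ w (Complex.exp s) 1 + v.im * fderiv ℝ w (Complex.exp s) Complex.I := by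
    intro v
    conv_lhs => rw [show v = v.re • (1 : ℂ) + v.im • Complex.I by simp [Complex.re_add_im]]
    rw [map_add, map_smul, map_smul, Complex.real_smul, Complex.real_smul]
  simp only [dbar, h', ContinuousLinearMap.comp_apply, expFDeriv_apply, one_mul]
  rw [hl (Complex.exp s), hl (Complex.I * Complex.exp s)]
  generalize Complex.exp s = τ
  rw [show conj τ = τ.re - τ.im * Complex.I from Complex.ext (by simp) (by simp)]
  simp only [Complex.I_mul_re, Complex.I_mul_im]
  push_cast
  linear_combination (1 / 2 * τ.im * fderiv ℝ w τ Complex.I) * Complex.I_sq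

end LogCoordinates

/-! ### The kernel in logarithmic coordinates -/

/-- The kernel `α * ζ * H₂(Z, ζ)`, `ζ = exp (α * s)`, `Z = exp (α * s₀)`, in the logarithmic
coordinate `s` of the sector ring. It has residue `1` at `s₀`. -/
noncomputable def stripKernel (r α : ℝ) (s₀ s : ℂ) : ℂ :=
  α * logKernel (r ^ (2 * α)) (Complex.exp (α * s₀)) (Complex.exp (α * s))

/-- The quotient `(exp (α * s) - exp (α * s₀)) / (s - s₀)`, an entire function of `s`. -/
noncomputable def expSlope (α : ℝ) (s₀ s : ℂ) : ℂ :=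
  dslope (fun s => Complex.exp (α * s)) s₀ s

/-- The strip kernel without its principal part `1 / (s - s₀)`. -/
noncomputable def stripReg (r α : ℝ) (s₀ s : ℂ) : ℂ :=
  deriv (expSlope α s₀) s / expSlope α s₀ s
    + α * regKernel (r ^ (2 * α)) (Complex.exp (α * s₀)) (Complex.exp (α * s))

section StripKernel

variable {r α : ℝ} {s₀ s : ℂ}

lemma rpow_two_mul_eq_sq (hr0 : 0 < r) : r ^ (2 * α) = (r ^ α) ^ 2 := by
  rw [mul_comm, Real.rpow_mul hr0.le]; norm_cast

lemma rpow_two_mul_pos (hr0 : 0 < r) : 0 < r ^ (2 * α) := Real.rpow_pos_of_pos hr0 _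

lemma rpow_two_mul_lt_one (hr0 : 0 < r) (hr1 : r < 1) (hα : 0 < α) : r ^ (2 * α) < 1 :=
  Real.rpow_lt_one hr0.le hr1 (by positivity)

lemma norm_exp_mul (α : ℝ) (s : ℂ) : ‖Complex.exp (α * s)‖ = Real.exp (α * s.re) := by
  rw [Complex.norm_exp, Complex.re_ofReal_mul]

lemma rpow_eq_exp_mul_log (hr0 : 0 < r) : r ^ α = Real.exp (α * Real.log r) := by
  rw [Real.rpow_def_of_pos hr0, mul_comm]

/-- Points of the open and of the closed rectangle give admissible points of the kernel, also
after conjugation. -/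
lemma admissible_exp (hr0 : 0 < r) (hr1 : r < 1) (hα : 0 < α)
    (h0 : Real.log r < s₀.re) (h0' : s₀.re < 0) (h : Real.log r ≤ s.re) (h' : s.re ≤ 0) :
    Admissible (r ^ (2 * α)) (Complex.exp (α * s₀)) (Complex.exp (α * s)) := by
  rw [rpow_two_mul_eq_sq hr0]
  refine Admissible.of_ring (Real.rpow_pos_of_pos hr0 _) (Real.rpow_lt_one hr0.le hr1 hα)
    ?_ ?_ ?_ ?_ <;> simp only [norm_exp_mul, rpow_eq_exp_mul_log hr0, Real.exp_lt_exp,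
      Real.exp_le_exp, Real.exp_lt_one_iff, Real.exp_le_one_iff] <;> nlinarith

lemma exp_mul_exp_ne_one (hα : 0 < α) (h0' : s₀.re < 0) (h' : s.re ≤ 0) :
    Complex.exp (α * s₀) * Complex.exp (α * s) ≠ 1 := by
  rw [← Complex.exp_add]
  intro h
  have := congrArg (‖·‖) h
  simp only [Complex.norm_exp, Complex.add_re, Complex.re_ofReal_mul, norm_one,
    Real.exp_eq_one_iff] at this
  nlinarith

/-- The map `s ↦ exp (α * s)` takes the value `exp (α * s₀)` in the closed rectangle and in its
mirror image at `s₀` only. -/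
lemma exp_mul_eq_iff (hα : 0 < α) (h0 : 0 < s₀.im) (h0' : s₀.im < Real.pi / α)
    (h : -(Real.pi / α) ≤ s.im) (h' : s.im ≤ Real.pi / α) :
    Complex.exp (α * s) = Complex.exp (α * s₀) ↔ s = s₀ := by
  refine ⟨fun he => ?_, fun he => by rw [he]⟩
  have hα' : (α : ℂ) ≠ 0 := by exact_mod_cast hα.ne'
  have e1 : α * (Real.pi / α) = Real.pi := by field_simp
  have a1 : α * s₀.im < Real.pi := by rw [← e1]; gcongr
  have a2 : α * s.im ≤ Real.pi := by rw [← e1]; gcongr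
  have a3 : -Real.pi ≤ α * s.im := by rw [← e1, ← mul_neg]; gcongr
  have a4 : 0 < α * s₀.im := by positivity
  obtain ⟨n, hn⟩ := Complex.exp_eq_exp_iff_exists_int.1 he
  have him := congrArg Complex.im hn
  have h2 : ((n : ℂ) * (2 * Real.pi * Complex.I)).im = n * (2 * Real.pi) := by simp
  rw [Complex.add_im, Complex.im_ofReal_mul, Complex.im_ofReal_mul, h2] at him
  have hpi := Real.pi_pos
  have n1 : n < 1 := by
    by_contra! hc
    have : (1 : ℝ) ≤ n := by exact_mod_cast hc
    nlinarith
  have n2 : -1 < n := by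
    by_contra! hc
    have : (n : ℝ) ≤ -1 := by exact_mod_cast hc
    nlinarith
  have n0 : n = 0 := by omega
  rw [n0] at hn
  simpa [hα'] using hn

lemma differentiable_expSlope (α : ℝ) (s₀ : ℂ) : Differentiable ℂ (expSlope α s₀) := by
  rw [← differentiableOn_univ]
  exact (Complex.differentiableOn_dslope univ_mem).2 (by fun_prop)

lemma sub_mul_expSlope (α : ℝ) (s₀ s : ℂ) :
    (s - s₀) * expSlope α s₀ s = Complex.exp (α * s) - Complex.exp (α * s₀) :=
  sub_smul_dslope (fun s => Complex.exp (α * s)) s₀ s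

lemma hasDerivAt_exp_mul (α : ℝ) (s : ℂ) :
    HasDerivAt (fun s => Complex.exp (α * s)) (Complex.exp (α * s) * α) s := by
  simpa using ((hasDerivAt_id s).const_mul (α : ℂ)).cexp

lemma expSlope_ne_zero (hα : 0 < α) (h0 : 0 < s₀.im) (h0' : s₀.im < Real.pi / α)
    (h : -(Real.pi / α) ≤ s.im) (h' : s.im ≤ Real.pi / α) : expSlope α s₀ s ≠ 0 := by
  rcases eq_or_ne s s₀ with rfl | hne
  · rw [expSlope, dslope_same, (hasDerivAt_exp_mul α s).deriv]
    exact mul_ne_zero (Complex.exp_ne_zero _) (by exact_mod_cast hα.ne')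
  · intro hz
    have := sub_mul_expSlope α s₀ s
    rw [hz, mul_zero] at this
    exact hne ((exp_mul_eq_iff hα h0 h0' h h').1 (sub_eq_zero.1 this.symm))

/-- The principal part of the strip kernel is split off by logarithmic differentiation of
`exp (α * s) - exp (α * s₀) = (s - s₀) * expSlope α s₀ s`. -/
lemma stripKernel_eq (hα : 0 < α) (h0 : 0 < s₀.im) (h0' : s₀.im < Real.pi / α)
    (h : -(Real.pi / α) ≤ s.im) (h' : s.im ≤ Real.pi / α) (hne : s ≠ s₀) :
    stripKernel r α s₀ s = 1 / (s - s₀) + stripReg r α s₀ s := by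
  have hk := expSlope_ne_zero hα h0 h0' h h'
  have hs := sub_ne_zero.2 hne
  have hd : Complex.exp (α * s) * α
      = expSlope α s₀ s + (s - s₀) * deriv (expSlope α s₀) s := by
    have h1 := ((hasDerivAt_id s).sub_const s₀).mul
      (differentiable_expSlope α s₀ s).hasDerivAt
    have h2 := (hasDerivAt_exp_mul α s).sub_const (Complex.exp (α * s₀))
    have e : (fun s => Complex.exp (α * s) - Complex.exp (α * s₀)) =
        (fun s => id s - s₀) * expSlope α s₀ := by
      ext t
      exact (sub_mul_expSlope α s₀ t).symm
    rw [e] at h2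
    simpa using h2.unique h1
  rw [stripKernel, logKernel, stripReg, ← sub_mul_expSlope, mul_add, ← mul_div_assoc,
    mul_comm (α : ℂ) (Complex.exp _), hd]
  field_simp
  ring

lemma differentiableAt_regKernel_exp (hr0 : 0 < r) (hr1 : r < 1) (hα : 0 < α)
    (h0 : Real.log r < s₀.re) (h0' : s₀.re < 0) (h : Real.log r ≤ s.re) (h' : s.re ≤ 0) :
    DifferentiableAt ℂ (fun s => regKernel (r ^ (2 * α)) (Complex.exp (α * s₀))
      (Complex.exp (α * s))) s :=
  DifferentiableAt.comp (f := fun s : ℂ => Complex.exp (α * s)) s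
    (differentiableAt_regKernel (rpow_two_mul_pos hr0) (rpow_two_mul_lt_one hr0 hr1 hα)
      (admissible_exp hr0 hr1 hα h0 h0' h h') (exp_mul_exp_ne_one hα h0' h'))
    (hasDerivAt_exp_mul α s).differentiableAt

lemma differentiableAt_stripReg (hr0 : 0 < r) (hr1 : r < 1) (hα : 0 < α)
    (hs₀ : s₀ ∈ openRect (Real.log r) 0 0 (Real.pi / α))
    (hs : s ∈ closedRect (Real.log r) 0 0 (Real.pi / α)) :
    DifferentiableAt ℂ (stripReg r α s₀) s := by
  obtain ⟨⟨a1, a2⟩, a3, a4⟩ := mem_openRect.1 hs₀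
  obtain ⟨⟨b1, b2⟩, b3, b4⟩ := mem_closedRect.1 hs
  have hpi : 0 < Real.pi / α := by positivity
  have hk := differentiable_expSlope α s₀
  have hk' : Differentiable ℂ (deriv (expSlope α s₀)) := by
    rw [← differentiableOn_univ]
    exact hk.differentiableOn.deriv isOpen_univ
  exact ((hk' s).fun_div (hk s) (expSlope_ne_zero hα a3 a4 (by linarith) b4)).fun_add
    ((differentiableAt_regKernel_exp hr0 hr1 hα a1 a2 b1 b2).const_mul _)

/-- Reflection in the real axis moves the pole of the strip kernel out of the rectangle. -/
lemma differentiableAt_conj_stripKernel (hr0 : 0 < r) (hr1 : r < 1) (hα : 0 < α)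
    (hs₀ : s₀ ∈ openRect (Real.log r) 0 0 (Real.pi / α))
    (hs : s ∈ closedRect (Real.log r) 0 0 (Real.pi / α)) :
    DifferentiableAt ℂ (fun s => conj (stripKernel r α s₀ (conj s))) s := by
  obtain ⟨⟨a1, a2⟩, a3, a4⟩ := mem_openRect.1 hs₀
  obtain ⟨⟨b1, b2⟩, b3, b4⟩ := mem_closedRect.1 hs
  have hne : Complex.exp (α * conj s) - Complex.exp (α * s₀) ≠ 0 := by
    rw [sub_ne_zero, Ne, exp_mul_eq_iff hα a3 a4 (by simpa) (by simp; linarith)]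
    rintro rfl
    simp at a3
    linarith
  have he := (hasDerivAt_exp_mul α (conj s)).differentiableAt
  have h : DifferentiableAt ℂ (stripKernel r α s₀) (conj s) :=
    ((he.fun_div (he.sub_const _) hne).fun_add (differentiableAt_regKernel_exp hr0 hr1 hα a1 a2
      (by simpa) (by simpa))).const_mul _
  simpa [Function.comp_def] using h.conj_conj

/-- The integrand of the area integral, multiplied by the Jacobian of the exponential, in the
logarithmic coordinate. -/
lemma norm_exp_sq_mul_areaIntegrand {w : ℂ → ℂ} (hr0 : 0 < r) (hr1 : r < 1) (hα : 1 / 2 ≤ α)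
    (hs₀ : s₀ ∈ openRect (Real.log r) 0 0 (Real.pi / α))
    (hs : s ∈ openRect (Real.log r) 0 0 (Real.pi / α))
    (hw : DifferentiableAt ℝ w (Complex.exp s)) :
    (‖Complex.exp s‖ ^ 2 : ℝ) * areaIntegrand r α w (Complex.exp s₀) (Complex.exp s) =
      1 / α * (dbar (fun s => w (Complex.exp s)) s * stripKernel r α s₀ s
        - conj (dbar (fun s => w (Complex.exp s)) s) * stripKernel r α s₀ (conj s)) := by
  have hα0 : 0 < α := by linarith
  have hα' : (α : ℂ) ≠ 0 := by exact_mod_cast hα0.ne'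
  have hpi : Real.pi / α ≤ 2 * Real.pi := by
    rw [div_le_iff₀ hα0]; nlinarith [Real.pi_pos]
  obtain ⟨⟨a1, a2⟩, a3, a4⟩ := mem_openRect.1 hs₀
  obtain ⟨⟨b1, b2⟩, b3, b4⟩ := mem_openRect.1 hs
  have hj : ((‖Complex.exp s‖ ^ 2 : ℝ) : ℂ) = Complex.exp s * conj (Complex.exp s) := by
    rw [Complex.mul_conj, Complex.normSq_eq_norm_sq]
  have hsplit : ∀ t : ℂ, Complex.exp (α * t) = Complex.exp ((α - 1 : ℝ) * t) * Complex.exp t := by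
    intro t
    rw [← Complex.exp_add]; congr 1; push_cast; ring
  have hconj : conj (Complex.exp (α * s)) = Complex.exp (α * conj s) := by
    rw [← Complex.exp_conj, map_mul, Complex.conj_ofReal]
  have hconj' : conj (Complex.exp ((α - 1 : ℝ) * s)) = Complex.exp ((α - 1 : ℝ) * conj s) := by
    rw [← Complex.exp_conj, map_mul, Complex.conj_ofReal]
  have m1 := mul_H₂_eq hr0 hr1 hα0 (admissible_exp hr0 hr1 hα0 a1 a2 b1.le b2.le)
  have m2 := mul_H₂_eq hr0 hr1 hα0
    (admissible_exp (s := conj s) hr0 hr1 hα0 a1 a2 (by simpa using b1.le) (by simpa using b2.le))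
  have hc : conj (Complex.exp s) = Complex.exp (conj s) := (Complex.exp_conj s).symm
  rw [hsplit s] at m1
  rw [hsplit (conj s)] at m2
  rw [areaIntegrand, branchPow_exp _ a3.le (by linarith), branchPow_exp _ b3.le (by linarith),
    branchPow_exp _ b3.le (by linarith), hconj, hconj', hj, dbar_comp_exp hw, stripKernel,
    stripKernel, hsplit s, hsplit (conj s), ← m1, ← m2, map_mul, Complex.conj_conj, hc]
  field_simp

end StripKernel

/-! ### Pairs of kernels, and exhaustion of a rectangle -/

section Integrability

variable {g A : ℂ → ℂ} {S K V : Set ℂ} {s₀ : ℂ}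

lemma integrableOn_mul_of_continuousOn (hS : MeasurableSet S) (hSK : S ⊆ K) (hK : IsCompact K)
    (hA : ContinuousOn A K) (hg : IntegrableOn g S) : IntegrableOn (fun s => g s * A s) S := by
  obtain ⟨C, hC⟩ := hK.exists_bound_of_continuousOn hA
  refine hg.mul_bdd (c := C) ((hA.mono hSK).aestronglyMeasurable hS) ?_
  exact (ae_restrict_iff' hS).2 (Eventually.of_forall fun s hs => hC s (hSK hs))

/-- Near the pole `g` is bounded, being continuous; away from it `1 / (s - s₀)` is bounded. -/
lemma integrableOn_mul_inv_sub (hS : MeasurableSet S) (hV : IsOpen V) (hg : ContinuousOn g V)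
    (hs₀ : s₀ ∈ V) (hi : IntegrableOn g S) :
    IntegrableOn (fun s => g s * (1 / (s - s₀))) S := by
  obtain ⟨δ, hδ, hb⟩ := Metric.nhds_basis_closedBall.mem_iff.1 (hV.mem_nhds hs₀)
  have hc : IsCompact (Metric.closedBall s₀ δ) := isCompact_closedBall _ _
  have h1 : IntegrableOn (fun s => g s * (1 / (s - s₀))) (Metric.closedBall s₀ δ) := by
    have := integrableOn_mul_of_continuousOn hc.measurableSet subset_rfl hc (hg.mono hb)
      (integrableOn_inv_sub hc s₀)
    exact this.congr (Eventually.of_forall fun s => mul_comm _ _)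
  have hS' : MeasurableSet (S \ Metric.closedBall s₀ δ) := hS.diff hc.measurableSet
  have h2 : IntegrableOn (fun s => g s * (1 / (s - s₀))) (S \ Metric.closedBall s₀ δ) := by
    refine (hi.mono_set Set.sdiff_subset).mul_bdd (c := 1 / δ)
      (measurable_const.div (measurable_id.sub_const s₀)).aestronglyMeasurable ?_
    refine (ae_restrict_iff' hS').2 (Eventually.of_forall fun s hs => ?_)
    have : δ < ‖s - s₀‖ := by simpa [dist_eq_norm] using hs.2
    rw [norm_div, norm_one]
    gcongr
  refine (h1.union h2).mono_set fun s hs => ?_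
  by_cases h : s ∈ Metric.closedBall s₀ δ
  exacts [Or.inl h, Or.inr ⟨hs, h⟩]

end Integrability

section PairIdentity

variable {F K L A : ℂ → ℂ} {V : Set ℂ} {s₀ : ℂ} {X₁ X₂ Y₁ Y₂ : ℝ}

/-- A kernel `K` with a simple pole of residue `1` at `s₀` on a closed rectangle, together with a
kernel `L` without poles there; `A` is the regular part of `K`. -/
structure KernelPair (K L A : ℂ → ℂ) (s₀ : ℂ) (X₁ X₂ Y₁ Y₂ : ℝ) : Prop where
  mem : s₀ ∈ openRect X₁ X₂ Y₁ Y₂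
  eq : ∀ s ∈ closedRect X₁ X₂ Y₁ Y₂, s ≠ s₀ → K s = 1 / (s - s₀) + A s
  differentiableAt : ∀ s ∈ closedRect X₁ X₂ Y₁ Y₂, DifferentiableAt ℂ A s
  differentiableAt' : ∀ s ∈ closedRect X₁ X₂ Y₁ Y₂, DifferentiableAt ℂ L s

namespace KernelPair

lemma continuousOn_reg (h : KernelPair K L A s₀ X₁ X₂ Y₁ Y₂) :
    ContinuousOn A (closedRect X₁ X₂ Y₁ Y₂) := fun s hs =>
  (h.differentiableAt s hs).continuousAt.continuousWithinAt

lemma continuousOn_right (h : KernelPair K L A s₀ X₁ X₂ Y₁ Y₂) :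
    ContinuousOn L (closedRect X₁ X₂ Y₁ Y₂) := fun s hs =>
  (h.differentiableAt' s hs).continuousAt.continuousWithinAt

lemma continuousOn_left (h : KernelPair K L A s₀ X₁ X₂ Y₁ Y₂) :
    ContinuousOn K (closedRect X₁ X₂ Y₁ Y₂ \ {s₀}) := by
  refine ContinuousOn.congr (f := fun s => 1 / (s - s₀) + A s) ?_ fun s hs => h.eq s hs.1 hs.2
  exact (continuousOn_const.div (by fun_prop) fun s hs => sub_ne_zero.2 hs.2).add
    (h.continuousOn_reg.mono Set.sdiff_subset)

lemma ae_eq {S : Set ℂ} (h : KernelPair K L A s₀ X₁ X₂ Y₁ Y₂) (hS : MeasurableSet S)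
    (hSR : S ⊆ openRect X₁ X₂ Y₁ Y₂) (g : ℂ → ℂ) :
    (fun s => g s * (1 / (s - s₀)) + g s * A s) =ᵐ[volume.restrict S] fun s => g s * K s := by
  have hae : ∀ᵐ s ∂(volume : Measure ℂ), s ≠ s₀ := by simp [ae_iff]
  refine (ae_restrict_iff' hS).2 (hae.mono fun s hne hs => ?_)
  dsimp only
  rw [h.eq s (openRect_subset_closedRect (hSR hs)) hne, mul_add]

lemma integrableOn_left {S : Set ℂ} (h : KernelPair K L A s₀ X₁ X₂ Y₁ Y₂) (hS : MeasurableSet S)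
    (hSR : S ⊆ openRect X₁ X₂ Y₁ Y₂) {g : ℂ → ℂ} (hg : ContinuousOn g (openRect X₁ X₂ Y₁ Y₂))
    (hi : IntegrableOn g S) : IntegrableOn (fun s => g s * K s) S :=
  ((integrableOn_mul_inv_sub hS isOpen_openRect hg h.mem hi).add
    (integrableOn_mul_of_continuousOn hS (hSR.trans openRect_subset_closedRect)
      isCompact_closedRect h.continuousOn_reg hi)).congr (h.ae_eq hS hSR g)

lemma integrableOn_right {S : Set ℂ} (h : KernelPair K L A s₀ X₁ X₂ Y₁ Y₂) (hS : MeasurableSet S)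
    (hSR : S ⊆ openRect X₁ X₂ Y₁ Y₂) {g : ℂ → ℂ} (hi : IntegrableOn g S) :
    IntegrableOn (fun s => conj (g s) * conj (L s)) S := by
  have := integrableOn_mul_of_continuousOn hS (hSR.trans openRect_subset_closedRect)
      isCompact_closedRect h.continuousOn_right hi
  have h2 := Complex.conjCLE.toContinuousLinearMap.integrable_comp this
  refine h2.congr (Eventually.of_forall fun s => ?_)
  exact map_mul (starRingEnd ℂ) _ _

/-- The Cauchy-Pompeiu formula for `K` combined with the conjugate of Green's theorem for `L`. -/
theorem contour_identity (h : KernelPair K L A s₀ X₁ X₂ Y₁ Y₂)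
    (hF : ContDiffOn ℝ 1 F (openRect X₁ X₂ Y₁ Y₂)) {x₁ x₂ y₁ y₂ : ℝ}
    (hR : closedRect x₁ x₂ y₁ y₂ ⊆ openRect X₁ X₂ Y₁ Y₂) (hs₀ : s₀ ∈ openRect x₁ x₂ y₁ y₂) :
    rectContour (fun s => F s * K s) x₁ x₂ y₁ y₂
        + conj (rectContour (fun s => F s * L s) x₁ x₂ y₁ y₂) =
      2 * Real.pi * Complex.I * F s₀ + 2 * Complex.I * ∫ s in openRect x₁ x₂ y₁ y₂,
        (dbar F s * K s - conj (dbar F s) * conj (L s)) := by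
  have hx : x₁ ≤ x₂ := (hs₀.1.1.trans hs₀.1.2).le
  have hy : y₁ ≤ y₂ := (hs₀.2.1.trans hs₀.2.2).le
  have hS := (isOpen_openRect (x₁ := x₁) (x₂ := x₂) (y₁ := y₁) (y₂ := y₂)).measurableSet
  have hsub : openRect x₁ x₂ y₁ y₂ ⊆ openRect X₁ X₂ Y₁ Y₂ := openRect_subset_closedRect.trans hR
  have hR' := hR.trans openRect_subset_closedRect
  have hcd := continuousOn_dbar isOpen_openRect hF
  have hi : IntegrableOn (dbar F) (openRect x₁ x₂ y₁ y₂) :=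
    ((hcd.mono hR).integrableOn_compact isCompact_closedRect).mono_set openRect_subset_closedRect
  have hne : ∀ s ∈ rectFrontier x₁ x₂ y₁ y₂, s - s₀ ≠ 0 := fun s hs h0 =>
    hs.2 (by rwa [sub_eq_zero.1 h0])
  have hcF : ContinuousOn F (rectFrontier x₁ x₂ y₁ y₂) :=
    hF.continuousOn.mono (Set.sdiff_subset.trans hR)
  have e1 : rectContour (fun s => F s * K s) x₁ x₂ y₁ y₂ =
      rectContour (fun s => F s * (1 / (s - s₀))) x₁ x₂ y₁ y₂
        + rectContour (fun s => F s * A s) x₁ x₂ y₁ y₂ := by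
    rw [← rectContour_add (f := fun s => F s * (1 / (s - s₀))) (g := fun s => F s * A s) hx hy
      (hcF.mul (continuousOn_const.div (by fun_prop) hne))
      (hcF.mul (h.continuousOn_reg.mono (Set.sdiff_subset.trans hR')))]
    refine rectContour_congr hx hy fun s hs => ?_
    rw [h.eq s (hR' hs.1) (sub_ne_zero.1 (hne s hs)), mul_add]
  rw [e1, rectContour_div_sub isOpen_openRect hF hR hs₀,
    rectContour_mul_holomorphic isOpen_openRect hF hR hx hy fun s hs =>
      h.differentiableAt s (hR' hs),
    rectContour_mul_holomorphic isOpen_openRect hF hR hx hy fun s hs =>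
      h.differentiableAt' s (hR' hs),
    integral_sub (h.integrableOn_left hS hsub hcd hi) (h.integrableOn_right hS hsub hi),
    ← integral_congr_ae (h.ae_eq hS hsub (dbar F)),
    integral_add (integrableOn_mul_inv_sub hS isOpen_openRect hcd h.mem hi)
      (integrableOn_mul_of_continuousOn hS (hsub.trans openRect_subset_closedRect)
      isCompact_closedRect h.continuousOn_reg hi)]
  simp only [map_mul, Complex.conj_I, ← integral_conj, map_ofNat]
  ring

end KernelPair

end PairIdentity

section Limit

variable {X₁ X₂ Y₁ Y₂ : ℝ} {s₀ : ℂ}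

lemma continuous_rectContour {f : ℂ → ℂ} (hf : Continuous f) :
    Continuous fun p : (ℝ × ℝ) × (ℝ × ℝ) => rectContour f p.1.1 p.1.2 p.2.1 p.2.2 := by
  have key : ∀ (γ : (ℝ × ℝ) × (ℝ × ℝ) → ℝ → ℂ) (a b : (ℝ × ℝ) × (ℝ × ℝ) → ℝ),
      Continuous γ.uncurry → Continuous a → Continuous b →
      Continuous fun p => ∫ t in a p..b p, f (γ p t) := by
    intro γ a b hγ ha hb
    have hfγ : Continuous (Function.uncurry fun p t => f (γ p t)) := hf.comp hγ
    have e : (fun p => ∫ t in a p..b p, f (γ p t)) =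
        fun p => (∫ t in (0 : ℝ)..b p, f (γ p t)) - ∫ t in (0 : ℝ)..a p, f (γ p t) := by
      ext p
      have hp : Continuous fun t => f (γ p t) :=
        hfγ.comp (continuous_const.prodMk continuous_id)
      rw [intervalIntegral.integral_interval_sub_left (hp.intervalIntegrable _ _)
        (hp.intervalIntegrable _ _)]
    rw [e]
    exact (intervalIntegral.continuous_parametric_intervalIntegral_of_continuous hfγ hb).sub
      (intervalIntegral.continuous_parametric_intervalIntegral_of_continuous hfγ ha)
  unfold rectContour
  refine (((key (fun p t => t + p.2.1 * Complex.I) _ _ ?_ ?_ ?_).sub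
    (key (fun p t => t + p.2.2 * Complex.I) _ _ ?_ ?_ ?_)).add
    (continuous_const.mul (key (fun p t => p.1.2 + t * Complex.I) _ _ ?_ ?_ ?_))).sub
    (continuous_const.mul (key (fun p t => p.1.1 + t * Complex.I) _ _ ?_ ?_ ?_))
  all_goals fun_prop

/-- The contour integrals over rectangles inside a given rectangle converge to the one over its
boundary, if the integrand is continuous on the closed rectangle apart from an interior point. -/
lemma tendsto_rectContour_rect {f : ℂ → ℂ} (hs₀ : s₀ ∈ openRect X₁ X₂ Y₁ Y₂)
    (hf : ContinuousOn f (closedRect X₁ X₂ Y₁ Y₂ \ {s₀})) :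
    Tendsto (fun p : (ℝ × ℝ) × (ℝ × ℝ) => rectContour f p.1.1 p.1.2 p.2.1 p.2.2)
      ((𝓝[>] X₁ ×ˢ 𝓝[<] X₂) ×ˢ (𝓝[>] Y₁ ×ˢ 𝓝[<] Y₂)) (𝓝 (rectContour f X₁ X₂ Y₁ Y₂)) := by
  obtain ⟨⟨h1, h2⟩, h3, h4⟩ := mem_openRect.1 hs₀
  obtain ⟨a₁, ha1, ha1'⟩ := exists_between h1
  obtain ⟨a₂, ha2, ha2'⟩ := exists_between h2
  obtain ⟨b₁, hb1, hb1'⟩ := exists_between h3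
  obtain ⟨b₂, hb2, hb2'⟩ := exists_between h4
  -- Away from a neighbourhood of the pole, `f` agrees with a function continuous on the plane.
  have hcl : IsClosed (closedRect X₁ X₂ Y₁ Y₂ \ openRect a₁ a₂ b₁ b₂) :=
    isCompact_closedRect.isClosed.sdiff isOpen_openRect
  have hcf : ContinuousOn f (closedRect X₁ X₂ Y₁ Y₂ \ openRect a₁ a₂ b₁ b₂) := by
    refine hf.mono fun s hs => ⟨hs.1, fun h => hs.2 ?_⟩
    rw [Set.mem_singleton_iff.1 h]
    exact ⟨⟨ha1', ha2⟩, hb1', hb2⟩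
  obtain ⟨g, hg⟩ := ContinuousMap.exists_restrict_eq hcl ⟨_, hcf.domRestrict⟩
  have hgf : ∀ s ∈ closedRect X₁ X₂ Y₁ Y₂ \ openRect a₁ a₂ b₁ b₂, g s = f s := fun s hs =>
    DFunLike.congr_fun hg ⟨s, hs⟩
  have heq : ∀ x₁ x₂ y₁ y₂ : ℝ, X₁ ≤ x₁ → x₁ ≤ a₁ → a₂ ≤ x₂ → x₂ ≤ X₂ → Y₁ ≤ y₁ → y₁ ≤ b₁ →
      b₂ ≤ y₂ → y₂ ≤ Y₂ → rectContour g x₁ x₂ y₁ y₂ = rectContour f x₁ x₂ y₁ y₂ := by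
    intro x₁ x₂ y₁ y₂ c1 c2 c3 c4 d1 d2 d3 d4
    refine rectContour_congr (by linarith) (by linarith) fun s hs => hgf s ⟨?_, fun h => hs.2 ?_⟩
    · obtain ⟨⟨e1, e2⟩, e3, e4⟩ := mem_closedRect.1 hs.1
      exact ⟨⟨c1.trans e1, e2.trans c4⟩, d1.trans e3, e4.trans d4⟩
    · obtain ⟨⟨e1, e2⟩, e3, e4⟩ := mem_openRect.1 h
      exact ⟨⟨c2.trans_lt e1, e2.trans_le c3⟩, d2.trans_lt e3, e4.trans_le d3⟩
  have hlim := (continuous_rectContour g.continuous).tendsto ((X₁, X₂), (Y₁, Y₂))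
  rw [heq X₁ X₂ Y₁ Y₂ le_rfl ha1.le ha2'.le le_rfl le_rfl hb1.le hb2'.le le_rfl] at hlim
  simp only [nhds_prod_eq] at hlim
  have hle := Filter.prod_mono
    (Filter.prod_mono (nhdsWithin_le_nhds (a := X₁) (s := Set.Ioi X₁))
      (nhdsWithin_le_nhds (a := X₂) (s := Set.Iio X₂)))
    (Filter.prod_mono (nhdsWithin_le_nhds (a := Y₁) (s := Set.Ioi Y₁))
      (nhdsWithin_le_nhds (a := Y₂) (s := Set.Iio Y₂)))
  refine (hlim.mono_left hle).congr' ?_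
  have hev := prod_mem_prod (prod_mem_prod (Ioo_mem_nhdsGT ha1) (Ioo_mem_nhdsLT ha2'))
    (prod_mem_prod (Ioo_mem_nhdsGT hb1) (Ioo_mem_nhdsLT hb2'))
  filter_upwards [hev] with p hp
  obtain ⟨⟨⟨c1, c2⟩, c3, c4⟩, ⟨d1, d2⟩, d3, d4⟩ := hp
  exact heq _ _ _ _ c1.le c2.le c3.le c4.le d1.le d2.le d3.le d4.le

lemma eventually_rect_subset (hs₀ : s₀ ∈ openRect X₁ X₂ Y₁ Y₂) :
    ∀ᶠ p : (ℝ × ℝ) × (ℝ × ℝ) in (𝓝[>] X₁ ×ˢ 𝓝[<] X₂) ×ˢ (𝓝[>] Y₁ ×ˢ 𝓝[<] Y₂),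
      closedRect p.1.1 p.1.2 p.2.1 p.2.2 ⊆ openRect X₁ X₂ Y₁ Y₂ ∧
        s₀ ∈ openRect p.1.1 p.1.2 p.2.1 p.2.2 := by
  obtain ⟨⟨h1, h2⟩, h3, h4⟩ := mem_openRect.1 hs₀
  have hev := prod_mem_prod (prod_mem_prod (Ioo_mem_nhdsGT h1) (Ioo_mem_nhdsLT h2))
    (prod_mem_prod (Ioo_mem_nhdsGT h3) (Ioo_mem_nhdsLT h4))
  filter_upwards [hev] with p hp
  obtain ⟨⟨⟨c1, c2⟩, c3, c4⟩, ⟨d1, d2⟩, d3, d4⟩ := hp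
  refine ⟨fun s hs => ?_, ⟨⟨c2, c3⟩, d2, d3⟩⟩
  obtain ⟨⟨e1, e2⟩, e3, e4⟩ := mem_closedRect.1 hs
  exact ⟨⟨c1.trans_le e1, e2.trans_lt c4⟩, d1.trans_le e3, e4.trans_lt d4⟩

/-- For an integrable function the integrals over smaller rectangles converge to the integral over
the whole rectangle. -/
lemma tendsto_setIntegral_openRect {g : ℂ → ℂ} (hs₀ : s₀ ∈ openRect X₁ X₂ Y₁ Y₂)
    (hg : IntegrableOn g (openRect X₁ X₂ Y₁ Y₂)) :
    Tendsto (fun p : (ℝ × ℝ) × (ℝ × ℝ) => ∫ s in openRect p.1.1 p.1.2 p.2.1 p.2.2, g s)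
      ((𝓝[>] X₁ ×ˢ 𝓝[<] X₂) ×ˢ (𝓝[>] Y₁ ×ˢ 𝓝[<] Y₂))
      (𝓝 (∫ s in openRect X₁ X₂ Y₁ Y₂, g s)) := by
  have hlim : Tendsto (fun p : (ℝ × ℝ) × (ℝ × ℝ) => ∫ s in openRect X₁ X₂ Y₁ Y₂,
      (openRect p.1.1 p.1.2 p.2.1 p.2.2).indicator g s)
      ((𝓝[>] X₁ ×ˢ 𝓝[<] X₂) ×ˢ (𝓝[>] Y₁ ×ˢ 𝓝[<] Y₂))
      (𝓝 (∫ s in openRect X₁ X₂ Y₁ Y₂, g s)) := by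
    refine tendsto_integral_filter_of_dominated_convergence (fun s => ‖g s‖) ?_ ?_ hg.norm ?_
    · exact Eventually.of_forall fun p =>
        hg.aestronglyMeasurable.indicator isOpen_openRect.measurableSet
    · exact Eventually.of_forall fun p => Eventually.of_forall fun s => norm_indicator_le_norm_self _ _
    · refine (ae_restrict_iff' isOpen_openRect.measurableSet).2 (Eventually.of_forall fun s hs => ?_)
      refine tendsto_const_nhds.congr' ?_
      filter_upwards [eventually_rect_subset hs] with p hp
      rw [Set.indicator_of_mem hp.2]
  refine hlim.congr' ?_
  filter_upwards [eventually_rect_subset hs₀] with p hp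
  rw [setIntegral_indicator isOpen_openRect.measurableSet,
    Set.inter_eq_self_of_subset_right (openRect_subset_closedRect.trans hp.1)]

end Limit

/-! ### The boundary integral -/

section Boundary

variable {r α : ℝ} {s₀ s : ℂ} {w : ℂ → ℂ}

/-- The kernel pair to which the Cauchy-Pompeiu formula is applied: the strip kernel, and its
reflection in the real axis. -/
lemma kernelPair_strip (hr0 : 0 < r) (hr1 : r < 1) (hα : 0 < α)
    (hs₀ : s₀ ∈ openRect (Real.log r) 0 0 (Real.pi / α)) :
    KernelPair (stripKernel r α s₀) (fun s => conj (stripKernel r α s₀ (conj s)))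
      (stripReg r α s₀) s₀ (Real.log r) 0 0 (Real.pi / α) where
  mem := hs₀
  eq s hs hne := by
    have hpi : 0 < Real.pi / α := by positivity
    exact stripKernel_eq hα hs₀.2.1 hs₀.2.2 (by linarith [hs.2.1]) hs.2.2 hne
  differentiableAt s hs := differentiableAt_stripReg hr0 hr1 hα hs₀ hs
  differentiableAt' s hs := differentiableAt_conj_stripKernel hr0 hr1 hα hs₀ hs

lemma rectContour_add_conj {x₁ x₂ y₁ y₂ : ℝ} (hx : x₁ ≤ x₂) (hy : y₁ ≤ y₂) {f g : ℂ → ℂ}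
    (hf : ContinuousOn f (rectFrontier x₁ x₂ y₁ y₂))
    (hg : ContinuousOn g (rectFrontier x₁ x₂ y₁ y₂)) :
    rectContour f x₁ x₂ y₁ y₂ + conj (rectContour g x₁ x₂ y₁ y₂) =
      (∫ x in x₁..x₂, (f (x + y₁ * Complex.I) + conj (g (x + y₁ * Complex.I))))
        - (∫ x in x₁..x₂, (f (x + y₂ * Complex.I) + conj (g (x + y₂ * Complex.I))))
        + Complex.I * (∫ y in y₁..y₂, (f (x₂ + y * Complex.I) - conj (g (x₂ + y * Complex.I))))
        - Complex.I * ∫ y in y₁..y₂, (f (x₁ + y * Complex.I) - conj (g (x₁ + y * Complex.I))) := by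
  obtain ⟨⟨f1, f2⟩, f3, f4⟩ := continuousOn_sides hx hy hf
  have hg' : ContinuousOn (fun s => conj (g s)) (rectFrontier x₁ x₂ y₁ y₂) :=
    Complex.continuous_conj.comp_continuousOn hg
  obtain ⟨⟨g1, g2⟩, g3, g4⟩ := continuousOn_sides hx hy hg'
  have hc : ∀ (a b : ℝ) (γ : ℝ → ℂ), conj (∫ t in a..b, γ t) = ∫ t in a..b, conj (γ t) :=
    fun a b γ => intervalIntegral.intervalIntegral_conj.symm
  unfold rectContour
  simp only [map_add, map_sub, map_mul, Complex.conj_I, hc]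
  rw [intervalIntegral.integral_add f1.intervalIntegrable g1.intervalIntegrable,
    intervalIntegral.integral_add f2.intervalIntegrable g2.intervalIntegrable,
    intervalIntegral.integral_sub f3.intervalIntegrable g3.intervalIntegrable,
    intervalIntegral.integral_sub f4.intervalIntegrable g4.intervalIntegrable]
  ring

lemma add_conj_mul (u k : ℂ) : u * k + conj u * k = 2 * ((u.re : ℂ) * k) := by
  have : u + conj u = 2 * u.re := by rw [Complex.add_conj]; push_cast; ring
  linear_combination k * this

lemma sub_conj_mul (u k c : ℂ) :
    u * (k + c) - conj u * (-k + c) = 2 * u.re * k + 2 * u.im * Complex.I * c := by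
  have h1 : u + conj u = 2 * u.re := by rw [Complex.add_conj]; push_cast; ring
  have h2 : u - conj u = 2 * u.im * Complex.I := by rw [Complex.sub_conj]; push_cast; ring
  linear_combination k * h1 + c * h2

/-- On the edges `Im s = 0` and `Im s = π / α` the powers `exp (α * s)` are real, so that the two
kernels of the pair agree up to conjugation. -/
lemma stripKernel_conj_of_edge (h : Complex.exp (α * conj s) = Complex.exp (α * s)) :
    stripKernel r α s₀ (conj s) = stripKernel r α s₀ s := by
  rw [stripKernel, stripKernel, h]

lemma exp_mul_conj_bottom (x : ℝ) : Complex.exp (α * conj (x + (0 : ℝ) * Complex.I : ℂ)) =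
    Complex.exp (α * (x + (0 : ℝ) * Complex.I)) := by
  simp

lemma exp_mul_conj_top (hα : 0 < α) (x : ℝ) :
    Complex.exp (α * conj (x + (Real.pi / α : ℝ) * Complex.I : ℂ)) =
      Complex.exp (α * (x + (Real.pi / α : ℝ) * Complex.I)) := by
  have hα' : (α : ℂ) ≠ 0 := by exact_mod_cast hα.ne'
  rw [Complex.exp_eq_exp_iff_exists_int]
  refine ⟨-1, ?_⟩
  simp only [map_add, map_mul, Complex.conj_ofReal, Complex.conj_I]
  push_cast
  field_simp
  ring

lemma stripKernel_eq_mul_H₂ (hr0 : 0 < r) (hr1 : r < 1) (hα : 0 < α)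
    (h0 : Real.log r < s₀.re) (h0' : s₀.re < 0) (h : Real.log r ≤ s.re) (h' : s.re ≤ 0) :
    stripKernel r α s₀ s = α * (H₂ r α (Complex.exp (α * s₀)) (Complex.exp (α * s))
      * Complex.exp ((α - 1 : ℝ) * s) * Complex.exp s) := by
  have hs : Complex.exp (α * s) = Complex.exp ((α - 1 : ℝ) * s) * Complex.exp s := by
    rw [← Complex.exp_add]; congr 1; push_cast; ring
  rw [stripKernel, ← mul_H₂_eq hr0 hr1 hα (admissible_exp hr0 hr1 hα h0 h0' h h')]
  conv_lhs => rw [mul_comm (Complex.exp (α * s)) (H₂ _ _ _ _)]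
  rw [mul_assoc (H₂ _ _ _ _), ← hs]

lemma conj_exp_mul (α : ℝ) (s : ℂ) : Complex.exp (α * conj s) = conj (Complex.exp (α * s)) := by
  rw [← Complex.exp_conj, map_mul, Complex.conj_ofReal]

/-- On the outer arc the kernel and its reflection are `± H₁ / 2 + 1`, up to the factor `α`. -/
lemma stripKernel_outer (hr0 : 0 < r) (hr1 : r < 1) (hα : 0 < α)
    (hs₀ : s₀ ∈ openRect (Real.log r) 0 0 (Real.pi / α)) (hre : s.re = 0)
    (him : 0 ≤ s.im) (him' : s.im ≤ Real.pi / α) :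
    stripKernel r α s₀ s =
        α * (H₁ r α (Complex.exp (α * s₀)) (Complex.exp (α * s)) / 2) + α ∧
      stripKernel r α s₀ (conj s) =
        -(α * (H₁ r α (Complex.exp (α * s₀)) (Complex.exp (α * s)) / 2)) + α := by
  obtain ⟨⟨a1, a2⟩, a3, a4⟩ := mem_openRect.1 hs₀
  have hpi : 0 < Real.pi / α := by positivity
  have hlog := Real.log_neg hr0 hr1
  have had := admissible_exp (s := s) hr0 hr1 hα a1 a2 (by linarith) (by linarith)
  have hne1 : Complex.exp (α * s) ≠ Complex.exp (α * s₀) := fun h => by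
    rw [exp_mul_eq_iff hα a3 a4 (by linarith) him'] at h
    rw [h] at hre; linarith
  have hne2 : conj (Complex.exp (α * s)) ≠ Complex.exp (α * s₀) := fun h => by
    rw [← conj_exp_mul, exp_mul_eq_iff hα a3 a4 (by simpa) (by simp; linarith)] at h
    rw [← h] at a3; simp at a3; linarith
  have hn : ‖Complex.exp (α * s)‖ = 1 := by rw [norm_exp_mul, hre]; simp
  have k1 := logKernel_of_norm_eq_one (Q := r ^ (2 * α)) hn hne2
  have k2 := logKernel_of_norm_eq_one (ζ := conj (Complex.exp (α * s))) (Q := r ^ (2 * α))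
    (by rw [RCLike.norm_conj, hn]) (by rwa [Complex.conj_conj])
  rw [Complex.conj_conj] at k2
  rw [stripKernel, stripKernel, conj_exp_mul, k1, k2, H₁_eq hr0 hr1 hα had hne1 hne2]
  constructor <;> ring

/-- On the inner arc the kernel and its reflection are `± H₁ / 2`, up to the factor `α`. -/
lemma stripKernel_inner (hr0 : 0 < r) (hr1 : r < 1) (hα : 0 < α)
    (hs₀ : s₀ ∈ openRect (Real.log r) 0 0 (Real.pi / α)) (hre : s.re = Real.log r)
    (him : 0 ≤ s.im) (him' : s.im ≤ Real.pi / α) :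
    stripKernel r α s₀ s =
        α * (H₁ r α (Complex.exp (α * s₀)) (Complex.exp (α * s)) / 2) + 0 ∧
      stripKernel r α s₀ (conj s) =
        -(α * (H₁ r α (Complex.exp (α * s₀)) (Complex.exp (α * s)) / 2)) + 0 := by
  obtain ⟨⟨a1, a2⟩, a3, a4⟩ := mem_openRect.1 hs₀
  have hpi : 0 < Real.pi / α := by positivity
  have hlog := Real.log_neg hr0 hr1
  have had := admissible_exp (s := s) hr0 hr1 hα a1 a2 (by linarith) (by linarith)
  have hne1 : Complex.exp (α * s) ≠ Complex.exp (α * s₀) := fun h => by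
    rw [exp_mul_eq_iff hα a3 a4 (by linarith) him'] at h
    rw [← h] at a1; linarith
  have hne2 : conj (Complex.exp (α * s)) ≠ Complex.exp (α * s₀) := fun h => by
    rw [← conj_exp_mul, exp_mul_eq_iff hα a3 a4 (by simpa) (by simp; linarith)] at h
    rw [← h] at a3; simp at a3; linarith
  have hn : ‖Complex.exp (α * s)‖ ^ 2 = r ^ (2 * α) := by
    rw [norm_exp_mul, hre, ← rpow_eq_exp_mul_log hr0, rpow_two_mul_eq_sq hr0]
  have hQ0 := rpow_two_mul_pos (α := α) hr0
  have hQ1 := rpow_two_mul_lt_one hr0 hr1 hα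
  have k1 := logKernel_of_norm_sq_eq hQ0 hQ1 had hn hne2
  have k2 := logKernel_of_norm_sq_eq hQ0 hQ1 had.conj_right
    (by rw [RCLike.norm_conj, hn]) (by rwa [Complex.conj_conj])
  rw [Complex.conj_conj] at k2
  rw [stripKernel, stripKernel, conj_exp_mul, k1, k2, H₁_eq hr0 hr1 hα had hne1 hne2]
  constructor <;> ring

lemma exp_image_Ioo (hr0 : 0 < r) : Real.exp '' Set.Ioo (Real.log r) 0 = Set.Ioo r 1 := by
  ext ρ
  constructor
  · rintro ⟨x, ⟨h1, h2⟩, rfl⟩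
    exact ⟨(Real.log_lt_iff_lt_exp hr0).1 h1, Real.exp_lt_one_iff.2 h2⟩
  · rintro ⟨h1, h2⟩
    have h0 := hr0.trans h1
    exact ⟨Real.log ρ, ⟨Real.log_lt_log hr0 h1, Real.log_neg h0 h2⟩, Real.exp_log h0⟩

lemma integral_exp_subst (hr0 : 0 < r) (hr1 : r < 1) (g : ℝ → ℂ) :
    ∫ ρ in r..1, g ρ = ∫ x in Real.log r..0, (Real.exp x : ℂ) * g (Real.exp x) := by
  rw [intervalIntegral.integral_of_le hr1.le, integral_Ioc_eq_integral_Ioo,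
    intervalIntegral.integral_of_le (Real.log_neg hr0 hr1).le, integral_Ioc_eq_integral_Ioo,
    ← exp_image_Ioo hr0, integral_image_eq_integral_abs_deriv_smul measurableSet_Ioo
      (fun x _ => (Real.hasDerivAt_exp x).hasDerivWithinAt) Real.exp_injective.injOn]
  simp only [abs_of_pos (Real.exp_pos _), Complex.real_smul]

lemma rayIntegral_eq (hr0 : 0 < r) (hr1 : r < 1) (t : ℝ) (G : ℝ → ℝ → ℂ) :
    rayIntegral t r 1 G =
      ∫ x in Real.log r..0, G (Real.exp x) t * Complex.exp (x + t * Complex.I) := by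
  rw [rayIntegral, integral_exp_subst hr0 hr1]
  congr 1; ext x
  rw [Complex.exp_add, Complex.ofReal_exp]
  ring

lemma arcIntegral_div_polar (x a b : ℝ) (G : ℝ → ℝ → ℂ) :
    arcIntegral (Real.exp x) a b (fun ρ t => G ρ t / polar ρ t) =
      Complex.I * ∫ t in a..b, G (Real.exp x) t := by
  rw [arcIntegral, ← intervalIntegral.integral_const_mul]
  congr 1; ext t
  have : polar (Real.exp x) t ≠ 0 := by rw [polar_exp]; exact Complex.exp_ne_zero _
  field_simp

lemma arcIntegral_swap (ρ a b : ℝ) (G : ℝ → ℝ → ℂ) :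
    arcIntegral ρ b a G = -arcIntegral ρ a b G := intervalIntegral.integral_symm a b

lemma rayIntegral_swap (t p q : ℝ) (G : ℝ → ℝ → ℂ) :
    rayIntegral t q p G = -rayIntegral t p q G := intervalIntegral.integral_symm p q

/-- The boundary integral for the kernel pair, in the form of integrals over the four sides of the
sector ring. -/
theorem boundary_eq (hr0 : 0 < r) (hr1 : r < 1) (hα : 0 < α)
    (hs₀ : s₀ ∈ openRect (Real.log r) 0 0 (Real.pi / α))
    (hw : ContinuousOn (fun s => w (Complex.exp s))
      (closedRect (Real.log r) 0 0 (Real.pi / α))) :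
    rectContour (fun s => w (Complex.exp s) * stripKernel r α s₀ s)
          (Real.log r) 0 0 (Real.pi / α)
        + conj (rectContour (fun s => w (Complex.exp s) * conj (stripKernel r α s₀ (conj s)))
          (Real.log r) 0 0 (Real.pi / α)) =
      2 * α * (rayIntegral (Real.pi / α) 1 r (fun ρ t =>
                ((w (polar ρ t)).re : ℂ) * H₂ r α (Complex.exp (α * s₀)) (polarPow α ρ t)
                  * polarPow (α - 1) ρ t)
              + rayIntegral 0 r 1 (fun ρ t =>
                ((w (polar ρ t)).re : ℂ) * H₂ r α (Complex.exp (α * s₀)) (polarPow α ρ t)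
                  * polarPow (α - 1) ρ t))
        + α * (arcIntegral 1 0 (Real.pi / α) (fun ρ t =>
                ((w (polar ρ t)).re : ℂ) * H₁ r α (Complex.exp (α * s₀)) (polarPow α ρ t)
                  / polar ρ t)
              + arcIntegral r (Real.pi / α) 0 (fun ρ t =>
                ((w (polar ρ t)).re : ℂ) * H₁ r α (Complex.exp (α * s₀)) (polarPow α ρ t)
                  / polar ρ t))
        + 2 * Complex.I * α * arcIntegral 1 0 (Real.pi / α) (fun ρ t =>
              ((w (polar ρ t)).im : ℂ) / polar ρ t) := by
  obtain ⟨⟨a1, a2⟩, a3, a4⟩ := mem_openRect.1 hs₀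
  have hlog := Real.log_neg hr0 hr1
  have hpi : 0 < Real.pi / α := by positivity
  have hP := kernelPair_strip hr0 hr1 hα hs₀
  have hsub : rectFrontier (Real.log r) 0 0 (Real.pi / α) ⊆
      closedRect (Real.log r) 0 0 (Real.pi / α) \ {s₀} := fun s hs =>
    ⟨hs.1, fun h => hs.2 (by rwa [Set.mem_singleton_iff.1 h])⟩
  have hcf : ContinuousOn (fun s => w (Complex.exp s) * stripKernel r α s₀ s)
      (rectFrontier (Real.log r) 0 0 (Real.pi / α)) :=
    (hw.mono Set.sdiff_subset).mul (hP.continuousOn_left.mono hsub)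
  have hcg : ContinuousOn (fun s => w (Complex.exp s) * conj (stripKernel r α s₀ (conj s)))
      (rectFrontier (Real.log r) 0 0 (Real.pi / α)) :=
    (hw.mono Set.sdiff_subset).mul (hP.continuousOn_right.mono Set.sdiff_subset)
  rw [rectContour_add_conj hlog.le hpi.le hcf hcg]
  -- On an edge with `ζ` real the two integrands add up to twice a real part.
  have hedge : ∀ y : ℝ, (∀ x : ℝ, Complex.exp (α * conj (x + y * Complex.I : ℂ)) =
      Complex.exp (α * (x + y * Complex.I))) →
      ∫ x in Real.log r..0, (w (Complex.exp (x + y * Complex.I))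
          * stripKernel r α s₀ (x + y * Complex.I)
          + conj (w (Complex.exp (x + y * Complex.I))
            * conj (stripKernel r α s₀ (conj (x + y * Complex.I : ℂ))))) =
        2 * α * rayIntegral y r 1 (fun ρ t =>
          ((w (polar ρ t)).re : ℂ) * H₂ r α (Complex.exp (α * s₀)) (polarPow α ρ t)
            * polarPow (α - 1) ρ t) := by
    intro y hy
    rw [rayIntegral_eq hr0 hr1, ← intervalIntegral.integral_const_mul]
    refine intervalIntegral.integral_congr fun x hx => ?_
    rw [Set.uIcc_of_le hlog.le] at hx
    rw [map_mul, Complex.conj_conj, stripKernel_conj_of_edge (hy x), add_conj_mul,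
      stripKernel_eq_mul_H₂ hr0 hr1 hα a1 a2 (by simpa using hx.1) (by simpa using hx.2),
      polar_exp, polarPow_exp, polarPow_exp]
    ring
  rw [hedge 0 exp_mul_conj_bottom, hedge (Real.pi / α) (exp_mul_conj_top hα)]
  -- On an arc the kernel is `k + c` and its reflection `-k + c`, with `k = α * H₁ / 2`; the
  -- constant `c` is `α` on the outer and `0` on the inner arc and multiplies `Im w`.
  have harc : ∀ (x : ℝ) (c : ℂ), (∀ y ∈ Set.Icc 0 (Real.pi / α),
        stripKernel r α s₀ (x + y * Complex.I) = α * (H₁ r α (Complex.exp (α * s₀))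
          (Complex.exp (α * (x + y * Complex.I))) / 2) + c ∧
        stripKernel r α s₀ (conj (x + y * Complex.I : ℂ)) = -(α * (H₁ r α (Complex.exp (α * s₀))
          (Complex.exp (α * (x + y * Complex.I))) / 2)) + c) →
      IntervalIntegrable (fun y : ℝ => w (Complex.exp (x + y * Complex.I))
          * stripKernel r α s₀ (x + y * Complex.I)
          - conj (w (Complex.exp (x + y * Complex.I))
            * conj (stripKernel r α s₀ (conj (x + y * Complex.I : ℂ))))) volume 0 (Real.pi / α) →
      ContinuousOn (fun y : ℝ => w (Complex.exp (x + y * Complex.I)))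
        (Set.uIcc 0 (Real.pi / α)) →
      Complex.I * ∫ y in 0..Real.pi / α, (w (Complex.exp (x + y * Complex.I))
          * stripKernel r α s₀ (x + y * Complex.I)
          - conj (w (Complex.exp (x + y * Complex.I))
            * conj (stripKernel r α s₀ (conj (x + y * Complex.I : ℂ))))) =
        α * arcIntegral (Real.exp x) 0 (Real.pi / α) (fun ρ t =>
                ((w (polar ρ t)).re : ℂ) * H₁ r α (Complex.exp (α * s₀)) (polarPow α ρ t)
                  / polar ρ t)
        + 2 * Complex.I * c * arcIntegral (Real.exp x) 0 (Real.pi / α) (fun ρ t =>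
              ((w (polar ρ t)).im : ℂ) / polar ρ t) := by
    intro x c hk hi hcw
    have him : IntervalIntegrable (fun y : ℝ => 2 * Complex.I * c *
        ((w (Complex.exp (x + y * Complex.I))).im : ℂ)) volume 0 (Real.pi / α) :=
      (continuousOn_const.mul ((Complex.continuous_ofReal.comp
        Complex.continuous_im).comp_continuousOn hcw)).intervalIntegrable
    have hd := intervalIntegral.integral_sub hi him
    rw [intervalIntegral.integral_const_mul] at hd
    have hre : ∫ y in 0..Real.pi / α, ((w (Complex.exp (x + y * Complex.I))
          * stripKernel r α s₀ (x + y * Complex.I)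
          - conj (w (Complex.exp (x + y * Complex.I))
            * conj (stripKernel r α s₀ (conj (x + y * Complex.I : ℂ)))))
          - 2 * Complex.I * c * ((w (Complex.exp (x + y * Complex.I))).im : ℂ)) =
        α * ∫ y in 0..Real.pi / α, ((w (Complex.exp (x + y * Complex.I))).re : ℂ) *
          H₁ r α (Complex.exp (α * s₀)) (Complex.exp (α * (x + y * Complex.I))) := by
      rw [← intervalIntegral.integral_const_mul]
      refine intervalIntegral.integral_congr fun y hy => ?_
      rw [Set.uIcc_of_le hpi.le] at hy
      rw [map_mul, Complex.conj_conj, (hk y hy).1, (hk y hy).2, sub_conj_mul]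
      ring
    rw [hre] at hd
    rw [arcIntegral_div_polar, arcIntegral_div_polar x 0 (Real.pi / α)
      (fun ρ t => ((w (polar ρ t)).im : ℂ))]
    simp only [polar_exp, polarPow_exp]
    linear_combination -Complex.I * hd
  have hcf' := hcf.sub (Complex.continuous_conj.comp_continuousOn hcg)
  obtain ⟨-, f3, f4⟩ := continuousOn_sides hlog.le hpi.le hcf'
  obtain ⟨-, w3, w4⟩ := continuousOn_sides hlog.le hpi.le (hw.mono
    (Set.sdiff_subset (t := openRect (Real.log r) 0 0 (Real.pi / α))))
  have hout := harc 0 α (fun y hy => stripKernel_outer hr0 hr1 hα hs₀ (by simp)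
    (by simpa using hy.1) (by simpa using hy.2)) f4.intervalIntegrable w4
  have hin := harc (Real.log r) 0 (fun y hy => stripKernel_inner hr0 hr1 hα hs₀ (by simp)
    (by simpa using hy.1) (by simpa using hy.2)) f3.intervalIntegrable w3
  rw [Real.exp_zero] at hout
  rw [Real.exp_log hr0] at hin
  rw [hout, hin, rayIntegral_swap _ r 1, arcIntegral_swap r 0]
  ring

end Boundary

/-! ### The area integral -/

section SectorRingArea

variable {r α : ℝ} {s₀ : ℂ} {w : ℂ → ℂ}

/-- The area integrand in the logarithmic coordinate, multiplied by the Jacobian of the exponential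
and by `α`. -/
noncomputable def stripIntegrand (r α : ℝ) (w : ℂ → ℂ) (s₀ s : ℂ) : ℂ :=
  dbar (fun s => w (Complex.exp s)) s * stripKernel r α s₀ s
    - conj (dbar (fun s => w (Complex.exp s)) s) * stripKernel r α s₀ (conj s)

lemma pi_div_le_two_pi (hα : 1 / 2 ≤ α) : Real.pi / α ≤ 2 * Real.pi := by
  rw [div_le_iff₀ (by linarith)]; nlinarith [Real.pi_pos]

lemma Omega_eq_image_exp (hr0 : 0 < r) (hα : 1 / 2 ≤ α) :
    Omega r α = Complex.exp '' openRect (Real.log r) 0 0 (Real.pi / α) := by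
  rw [Omega, region_eq_image_exp hr0 one_pos le_rfl (pi_div_le_two_pi hα), Real.log_one]

lemma isOpen_Omega (hr0 : 0 < r) (hα : 1 / 2 ≤ α) : IsOpen (Omega r α) := by
  rw [Omega_eq_image_exp hr0 hα]
  exact Complex.isOpenMap_exp _ isOpen_openRect

lemma contDiffOn_comp_exp (hr0 : 0 < r) (hα : 1 / 2 ≤ α) (hw : ContDiffOn ℝ 1 w (Omega r α)) :
    ContDiffOn ℝ 1 (fun s => w (Complex.exp s)) (openRect (Real.log r) 0 0 (Real.pi / α)) := by
  rw [Omega_eq_image_exp hr0 hα] at hw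
  exact hw.comp Complex.contDiff_exp.contDiffOn (Set.mapsTo_image _ _)

lemma continuousOn_comp_exp (hr0 : 0 < r) (hr1 : r < 1) (hα : 1 / 2 ≤ α)
    (hw : ContinuousOn w (closure (Omega r α))) :
    ContinuousOn (fun s => w (Complex.exp s)) (closedRect (Real.log r) 0 0 (Real.pi / α)) := by
  have hpi : 0 < Real.pi / α := div_pos Real.pi_pos (by linarith)
  refine hw.comp Complex.continuous_exp.continuousOn fun s hs => ?_
  rw [Omega_eq_image_exp hr0 hα]
  refine image_closure_subset_closure_image Complex.continuous_exp ⟨s, ?_, rfl⟩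
  rwa [openRect, Complex.closure_reProdIm, closure_Ioo (Real.log_neg hr0 hr1).ne,
    closure_Ioo hpi.ne]

/-- Change of variables `τ = exp s` in the area integral over a sector ring on which the Wirtinger
derivative is integrable. -/
lemma areaIntegrand_image_exp (hr0 : 0 < r) (hr1 : r < 1) (hα : 1 / 2 ≤ α)
    (hw : ContDiffOn ℝ 1 w (Omega r α)) (hs₀ : s₀ ∈ openRect (Real.log r) 0 0 (Real.pi / α))
    {x₁ x₂ y₁ y₂ : ℝ} (hy₁ : 0 ≤ y₁) (hy₂ : y₂ ≤ Real.pi / α)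
    (hsub : openRect x₁ x₂ y₁ y₂ ⊆ openRect (Real.log r) 0 0 (Real.pi / α))
    (hi : IntegrableOn (dbar fun s => w (Complex.exp s)) (openRect x₁ x₂ y₁ y₂)) :
    IntegrableOn (stripIntegrand r α w s₀) (openRect x₁ x₂ y₁ y₂) ∧
      IntegrableOn (areaIntegrand r α w (Complex.exp s₀))
        (Complex.exp '' openRect x₁ x₂ y₁ y₂) ∧
      ∫ τ in Complex.exp '' openRect x₁ x₂ y₁ y₂, areaIntegrand r α w (Complex.exp s₀) τ =
        1 / α * ∫ s in openRect x₁ x₂ y₁ y₂, stripIntegrand r α w s₀ s := by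
  have hα0 : 0 < α := by linarith
  have hP := kernelPair_strip hr0 hr1 hα0 hs₀
  have hm := (isOpen_openRect (x₁ := x₁) (x₂ := x₂) (y₁ := y₁) (y₂ := y₂)).measurableSet
  have hcd := continuousOn_dbar isOpen_openRect (contDiffOn_comp_exp hr0 hα hw)
  have h2π : y₂ ≤ 2 * Real.pi := hy₂.trans (pi_div_le_two_pi hα)
  have hstrip : IntegrableOn (stripIntegrand r α w s₀) (openRect x₁ x₂ y₁ y₂) := by
    have h2 := hP.integrableOn_right hm hsub hi
    simp only [Complex.conj_conj] at h2
    exact (hP.integrableOn_left hm hsub hcd hi).sub h2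
  have heq : Set.EqOn (fun s => 1 / (α : ℂ) * stripIntegrand r α w s₀ s)
      (fun s => ((‖Complex.exp s‖ ^ 2 : ℝ) : ℂ)
        * areaIntegrand r α w (Complex.exp s₀) (Complex.exp s)) (openRect x₁ x₂ y₁ y₂) := by
    intro s hs
    have hmem : Complex.exp s ∈ Omega r α := by
      rw [Omega_eq_image_exp hr0 hα]; exact ⟨s, hsub hs, rfl⟩
    exact (norm_exp_sq_mul_areaIntegrand hr0 hr1 hα hs₀ (hsub hs)
      (differentiableAt_of_contDiffOn (isOpen_Omega hr0 hα) hw hmem)).symm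
  refine ⟨hstrip, ?_, ?_⟩
  · rw [integrableOn_image_exp_iff hy₁ h2π]
    exact IntegrableOn.congr_fun (hstrip.const_mul _) heq hm
  · rw [integral_image_exp hy₁ h2π, ← integral_const_mul]
    exact (setIntegral_congr_fun hm heq).symm

/-- Integrability of the Wirtinger derivative on the sector ring passes to the logarithmic
coordinate: the two integrands differ by the bounded factor `1 / exp s`. -/
lemma integrableOn_dbar_comp_exp (hr0 : 0 < r) (hα : 1 / 2 ≤ α)
    (hw : ContDiffOn ℝ 1 w (Omega r α)) (hi : IntegrableOn (dbar w) (Omega r α)) :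
    IntegrableOn (dbar fun s => w (Complex.exp s)) (openRect (Real.log r) 0 0 (Real.pi / α)) := by
  have hm := (isOpen_openRect (x₁ := Real.log r) (x₂ := 0) (y₁ := 0)
    (y₂ := Real.pi / α)).measurableSet
  have hO := Omega_eq_image_exp hr0 hα
  rw [hO, integrableOn_image_exp_iff le_rfl (pi_div_le_two_pi hα)] at hi
  have h2 := integrableOn_mul_of_continuousOn (A := fun s => Complex.exp (-s)) hm
    openRect_subset_closedRect isCompact_closedRect
    (by fun_prop) hi
  refine h2.congr_fun (fun s hs => ?_) hm
  have hmem : Complex.exp s ∈ Omega r α := by rw [hO]; exact ⟨s, hs, rfl⟩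
  have hj : ((‖Complex.exp s‖ ^ 2 : ℝ) : ℂ) = Complex.exp s * conj (Complex.exp s) := by
    rw [Complex.mul_conj, Complex.normSq_eq_norm_sq]
  have hn := Complex.exp_ne_zero s
  simp only
  rw [dbar_comp_exp (differentiableAt_of_contDiffOn (isOpen_Omega hr0 hα) hw hmem), hj,
    Complex.exp_neg]
  field_simp

lemma tendsto_log_rect (hr0 : 0 < r) (h : ℝ) :
    Tendsto (fun p : (ℝ × ℝ) × (ℝ × ℝ) => ((Real.log p.1.1, Real.log p.1.2), p.2))
      ((𝓝[>] r ×ˢ 𝓝[<] (1 : ℝ)) ×ˢ (𝓝[>] (0 : ℝ) ×ˢ 𝓝[<] h))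
      ((𝓝[>] (Real.log r) ×ˢ 𝓝[<] (0 : ℝ)) ×ˢ (𝓝[>] (0 : ℝ) ×ˢ 𝓝[<] h)) := by
  have h1 : Tendsto Real.log (𝓝[>] r) (𝓝[>] (Real.log r)) :=
    tendsto_nhdsWithin_iff.2 ⟨(Real.continuousAt_log hr0.ne').tendsto.mono_left
      nhdsWithin_le_nhds, by
        filter_upwards [self_mem_nhdsWithin] with x hx using Real.log_lt_log hr0 hx⟩
  have h2 : Tendsto Real.log (𝓝[<] 1) (𝓝[<] 0) := by
    refine tendsto_nhdsWithin_iff.2 ⟨?_, ?_⟩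
    · have := (Real.continuousAt_log one_ne_zero).tendsto.mono_left
        (nhdsWithin_le_nhds (s := Set.Iio (1 : ℝ)))
      rwa [Real.log_one] at this
    · filter_upwards [Ioo_mem_nhdsLT (zero_lt_one' ℝ)] with x hx using Real.log_neg hx.1 hx.2
  exact (h1.prodMap h2).prodMap tendsto_id

/-- The integrals of the area integrand over the smaller sector rings are eventually those over
rectangles in the logarithmic coordinate. -/
lemma eventually_region_eq (hr0 : 0 < r) (hα : 1 / 2 ≤ α) :
    ∀ᶠ p : (ℝ × ℝ) × (ℝ × ℝ) in
      (𝓝[>] r ×ˢ 𝓝[<] (1 : ℝ)) ×ˢ (𝓝[>] (0 : ℝ) ×ˢ 𝓝[<] (Real.pi / α)),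
      region p.1.1 p.1.2 p.2.1 p.2.2 =
          Complex.exp '' openRect (Real.log p.1.1) (Real.log p.1.2) p.2.1 p.2.2 ∧
        0 ≤ p.2.1 ∧ p.2.2 ≤ Real.pi / α := by
  have hev := prod_mem_prod
    (prod_mem_prod (self_mem_nhdsWithin (a := r) (s := Set.Ioi r)) (Ioo_mem_nhdsLT (zero_lt_one' ℝ)))
    (prod_mem_prod (self_mem_nhdsWithin (a := (0 : ℝ)) (s := Set.Ioi 0))
      (self_mem_nhdsWithin (a := Real.pi / α) (s := Set.Iio (Real.pi / α))))
  filter_upwards [hev] with p hp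
  obtain ⟨⟨h1, h2, -⟩, h3, h4⟩ := hp
  have h1 : r < p.1.1 := h1
  have h3 : 0 < p.2.1 := h3
  have h4 : p.2.2 < Real.pi / α := h4
  exact ⟨region_eq_image_exp (hr0.trans h1) h2 h3.le (h4.le.trans (pi_div_le_two_pi hα)),
    h3.le, h4.le⟩

lemma integrableOn_dbar_rect {F : ℂ → ℂ} {X₁ X₂ Y₁ Y₂ x₁ x₂ y₁ y₂ : ℝ}
    (hF : ContDiffOn ℝ 1 F (openRect X₁ X₂ Y₁ Y₂))
    (hsub : closedRect x₁ x₂ y₁ y₂ ⊆ openRect X₁ X₂ Y₁ Y₂) :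
    IntegrableOn (dbar F) (openRect x₁ x₂ y₁ y₂) :=
  (((continuousOn_dbar isOpen_openRect hF).mono hsub).integrableOn_compact
    isCompact_closedRect).mono_set openRect_subset_closedRect

lemma integrableOn_areaIntegrand_region (hr0 : 0 < r) (hr1 : r < 1) (hα : 1 / 2 ≤ α)
    (hw : ContDiffOn ℝ 1 w (Omega r α)) (hs₀ : s₀ ∈ openRect (Real.log r) 0 0 (Real.pi / α))
    {r₁ r₂ a b : ℝ} (hr₁ : r < r₁) (hr₂ : r₂ < 1) (ha : 0 < a) (hb : b < Real.pi / α) :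
    IntegrableOn (areaIntegrand r α w (Complex.exp s₀)) (region r₁ r₂ a b) := by
  rcases le_or_gt r₂ 0 with h | h
  · have : region r₁ r₂ a b = ∅ :=
      Set.eq_empty_of_forall_notMem fun τ hτ => absurd (hτ.2.1.trans_le h) (norm_nonneg τ).not_gt
    rw [this]
    exact integrableOn_empty
  · rw [region_eq_image_exp (hr0.trans hr₁) h ha.le (hb.le.trans (pi_div_le_two_pi hα))]
    have hsub : closedRect (Real.log r₁) (Real.log r₂) a b ⊆
        openRect (Real.log r) 0 0 (Real.pi / α) := by
      intro s hs
      obtain ⟨⟨e1, e2⟩, e3, e4⟩ := mem_closedRect.1 hs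
      exact ⟨⟨(Real.log_lt_log hr0 hr₁).trans_le e1, e2.trans_lt (Real.log_neg h hr₂)⟩,
        ha.trans_le e3, e4.trans_lt hb⟩
    exact (areaIntegrand_image_exp hr0 hr1 hα hw hs₀ ha.le hb.le
      (openRect_subset_closedRect.trans hsub)
      (integrableOn_dbar_rect (contDiffOn_comp_exp hr0 hα hw) hsub)).2.1

end SectorRingArea

end SectorRing

open SectorRing in
theorem theorem2p1 (r α : ℝ) (hr0 : 0 < r) (hr1 : r < 1) (hα : 1 / 2 ≤ α)
    (w : ℂ → ℂ) (hw1 : ContDiffOn ℝ 1 w (Omega r α))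
    (hw0 : ContinuousOn w (closure (Omega r α)))
    (z : ℂ) (hz : z ∈ Omega r α) :
    ∃ J : ℂ,
      HasAreaIntegral r α (areaIntegrand r α w z) J ∧
      (IntegrableOn (dbar w) (Omega r α) volume →
        IntegrableOn (areaIntegrand r α w z) (Omega r α) volume ∧
          ∫ τ in Omega r α, areaIntegrand r α w z τ = J) ∧
      w z =
        (α : ℂ) / (2 * Real.pi * Complex.I) *
            (arcIntegral 1 0 (Real.pi / α) (fun ρ t =>
                ((w (polar ρ t)).re : ℂ) * H₁ r α (branchPow α z) (polarPow α ρ t) / polar ρ t)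
              + arcIntegral r (Real.pi / α) 0 (fun ρ t =>
                ((w (polar ρ t)).re : ℂ) * H₁ r α (branchPow α z) (polarPow α ρ t) / polar ρ t))
          + (α : ℂ) / (Real.pi * Complex.I) *
            (rayIntegral (Real.pi / α) 1 r (fun ρ t =>
                ((w (polar ρ t)).re : ℂ) * H₂ r α (branchPow α z) (polarPow α ρ t)
                  * polarPow (α - 1) ρ t)
              + rayIntegral 0 r 1 (fun ρ t =>
                ((w (polar ρ t)).re : ℂ) * H₂ r α (branchPow α z) (polarPow α ρ t)
                  * polarPow (α - 1) ρ t))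
          + (α : ℂ) / Real.pi *
            arcIntegral 1 0 (Real.pi / α) (fun ρ t =>
              ((w (polar ρ t)).im : ℂ) / polar ρ t)
          - (α : ℂ) / Real.pi * J := by
  have hα0 : 0 < α := by linarith
  have hα' : (α : ℂ) ≠ 0 := by exact_mod_cast hα0.ne'
  have hpi' : (Real.pi : ℂ) ≠ 0 := by exact_mod_cast Real.pi_ne_zero
  have hO := Omega_eq_image_exp hr0 hα
  rw [hO] at hz
  obtain ⟨s₀, hs₀, rfl⟩ := hz
  have hP := kernelPair_strip hr0 hr1 hα0 hs₀
  have hF := contDiffOn_comp_exp hr0 hα hw1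
  have hFc := continuousOn_comp_exp hr0 hr1 hα hw0
  have hb := boundary_eq hr0 hr1 hα0 hs₀ hFc
  have hZ : branchPow α (Complex.exp s₀) = Complex.exp (α * s₀) :=
    branchPow_exp α hs₀.2.1.le (hs₀.2.2.trans_le (pi_div_le_two_pi hα))
  have hlim : Tendsto (fun p : (ℝ × ℝ) × (ℝ × ℝ) =>
      rectContour (fun s => w (Complex.exp s) * stripKernel r α s₀ s) p.1.1 p.1.2 p.2.1 p.2.2
        + conj (rectContour (fun s => w (Complex.exp s) * conj (stripKernel r α s₀ (conj s)))
          p.1.1 p.1.2 p.2.1 p.2.2)) _ (𝓝 _) := (tendsto_rectContour_rect hs₀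
      ((hFc.mono Set.sdiff_subset).mul hP.continuousOn_left)).add
    ((Complex.continuous_conj.tendsto _).comp (tendsto_rectContour_rect hs₀
      ((hFc.mul hP.continuousOn_right).mono Set.sdiff_subset)))
  set B := rectContour (fun s => w (Complex.exp s) * stripKernel r α s₀ s)
          (Real.log r) 0 0 (Real.pi / α)
        + conj (rectContour (fun s => w (Complex.exp s) * conj (stripKernel r α s₀ (conj s)))
          (Real.log r) 0 0 (Real.pi / α))
  have hJ : Tendsto (fun p : (ℝ × ℝ) × (ℝ × ℝ) =>
      ∫ τ in region p.1.1 p.1.2 p.2.1 p.2.2, areaIntegrand r α w (Complex.exp s₀) τ)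
      ((𝓝[>] r ×ˢ 𝓝[<] (1 : ℝ)) ×ˢ (𝓝[>] (0 : ℝ) ×ˢ 𝓝[<] (Real.pi / α)))
      (𝓝 (1 / (2 * α * Complex.I) * (B - 2 * Real.pi * Complex.I * w (Complex.exp s₀)))) := by
    have h1 := ((hlim.sub_const (2 * Real.pi * Complex.I * w (Complex.exp s₀))).const_mul
      (1 / (2 * α * Complex.I))).comp (tendsto_log_rect hr0 (Real.pi / α))
    refine h1.congr' ?_
    filter_upwards [eventually_region_eq hr0 hα, (tendsto_log_rect hr0 (Real.pi / α)).eventually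
      (eventually_rect_subset hs₀)] with p hp hp'
    obtain ⟨hp1, hp2, hp3⟩ := hp
    rw [hp1, (areaIntegrand_image_exp hr0 hr1 hα hw1 hs₀ hp2 hp3
      (openRect_subset_closedRect.trans hp'.1) (integrableOn_dbar_rect hF hp'.1)).2.2]
    have hid := hP.contour_identity hF hp'.1 hp'.2
    simp only [Complex.conj_conj] at hid
    simp only [Function.comp_apply, hid, stripIntegrand]
    field_simp
    ring
  refine ⟨_, ⟨fun r₁ r₂ a b h1 h2 h3 h4 => integrableOn_areaIntegrand_region hr0 hr1 hα hw1 hs₀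
    h1 h2 h3 h4, hJ⟩, fun hi => ?_, ?_⟩
  · obtain ⟨i1, i2, i3⟩ := areaIntegrand_image_exp hr0 hr1 hα hw1 hs₀ le_rfl le_rfl subset_rfl
      (integrableOn_dbar_comp_exp hr0 hα hw1 hi)
    rw [hO]
    refine ⟨i2, tendsto_nhds_unique ?_ hJ⟩
    have h1 := ((tendsto_setIntegral_openRect hs₀ i1).const_mul (1 / (α : ℂ))).comp
      (tendsto_log_rect hr0 (Real.pi / α))
    rw [i3]
    refine h1.congr' ?_
    filter_upwards [eventually_region_eq hr0 hα, (tendsto_log_rect hr0 (Real.pi / α)).eventually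
      (eventually_rect_subset hs₀)] with p hp hp'
    obtain ⟨hp1, hp2, hp3⟩ := hp
    rw [hp1, (areaIntegrand_image_exp hr0 hr1 hα hw1 hs₀ hp2 hp3
      (openRect_subset_closedRect.trans hp'.1) (integrableOn_dbar_rect hF hp'.1)).2.2]
    rfl
  · rw [hZ, hb]
    field_simp
    ring_nf
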